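/- \textbf{Definitions.} A bipartite graph $X=(V_0,V_1,E)$, $E\subseteq V_0\times V_1$, with $V_0,V_1$ finite, is $(w_0,w_1)$-regular if every vertex of $V_0$ has $w_0$ neighbours and every vertex of $V_1$ has $w_1$ neighbours. A $(w_0,w_1)$-regular $X$ is a 2-sided $(c,\epsilon)$-lossless expander if every $S\subseteq V_0$ with $|S|<c|V_0|$ has at least $(1-\epsilon)w_0|S|$ neighbours in $V_1$, and every $S\subseteq V_1$ with $|S|<c|V_1|$ has at least $(1-\epsilon)w_1|S|$ neighbours in $V_0$. A free $G$-action on $X$ consists of free actions of $G$ on $V_0$ and on $V_1$ that preserve $E$. A quantum CSS code is given by matrices $H_x,H_z$ over $\mathbb F_2$ with $n$ columns (the qubits) and $H_xH_z^T=0$. Its dimension is $k=n-\operatorname{rank}H_x-\operatorname{rank}H_z$; its distance $d$ is the minimal number of qubits on which a nontrivial logical operator (a Pauli string that commutes with all the stabilizers and is, up to a phase, not itself a stabilizer) acts nontrivially; its weight is the maximal weight of the rows and columns of $H_x$ and $H_z$. For bipartite graphs $X_\updownarrow=(V_{0*},V_{1*},E_\updownarrow)$ and $X_\leftrightarrow=(V_{*0},V_{*1},E_\leftrightarrow)$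 with free actions of the same finite group $G$, the balanced product $X_\updownarrow\times_G X_\leftrightarrow$ has vertex sets $V_{\alpha\beta}=(V_{\alpha*}\times V_{*\beta})/G$ (quotients by the diagonal action) and edges $[x_0,y]\sim[x_1,y]$ for $(x_0,x_1)\in E_\updownarrow$, $y\in V_{*\beta}$, and $[x,y_0]\sim[x,y_1]$ for $x\in V_{\alpha*}$, $(y_0,y_1)\in E_\leftrightarrow$. Its adjacency matrices give a chain complex $\mathbb F_2^{V_{00}}\xrightarrow{\partial_2}\mathbb F_2^{V_{10}}\oplus\mathbb F_2^{V_{01}}\xrightarrow{\partial_1}\mathbb F_2^{V_{11}}$. Its CSS code has $V_{10}\sqcup V_{01}$ as qubits, $V_{11}$ as X-stabilizers and $V_{00}$ as Z-stabilizers, the stabilizer of a vertex acting on the neighbours of that vertex. \textbf{Conjecture 1.} There is a sequence of finite groups $G_i$ with $|G_i|\to\infty$ such that for every $\epsilon>0$ and every nonempty open interval $I\subseteq(0,1)$ there are $w_0,w_1\in\mathbb N$, $c>0$, constants $0<\kappa_1\le\kappa_2$ and $i_0$ such that $w_0/w_1\in I$ and for every $i\ge i_0$ there is a $(w_0,w_1)$-regular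 bipartite graph $X=(V_0,V_1,E)$ with a free $G_i$-action that is a 2-sided $(c,\epsilon)$-lossless expander and has $\kappa_1|G_i|\le|V_0|\le\kappa_2|G_i|$. \textbf{Theorem 1.} Assume Conjecture 1. Then for every $0<r<1$ there are $\delta>0$, $w\in\mathbb N$ and an infinite sequence of CSS codes $C_i$ with parameters $[[n_i,k_i,d_i]]$ such that $n_i\to\infty$ and, for all $i$, $k_i/n_i\ge r$, $d_i/n_i\ge\delta$ and $C_i$ has weight $w$. Moreover, $C_i$ can be taken to be the CSS code of a balanced product $X^{(i)}_\updownarrow\times_{G_i}X^{(i)}_\leftrightarrow$, where the $G_i$ are finite groups with $|G_i|\to\infty$ (not necessarily the sequence of Conjecture 1), $X^{(i)}_\updownarrow$ and $X^{(i)}_\leftrightarrow$ are bipartite graphs with free $G_i$-actions, and, with parameters that do not depend on $i$: $X^{(i)}_\updownarrow$ is a $(w_\downarrow,w_\uparrow)$-regular 2-sided $(c_\updownarrow,\epsilon_\updownarrow)$-lossless expander, $X^{(i)}_\leftrightarrow$ is a $(w_\rightarrow,w_\leftarrow)$-regular 2-sided $(c_\leftrightarrow,\epsilon_\leftrightarrow)$-lossless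 expander, $c_\updownarrow,c_\leftrightarrow,\epsilon_\updownarrow,\epsilon_\leftrightarrow>0$, $|V^{(i)}_{0*}|=\Theta(|G_i|)$, $|V^{(i)}_{*0}|=\Theta(|G_i|)$, $$\frac{(w_\downarrow-w_\uparrow)(w_\leftarrow-w_\rightarrow)}{w_\downarrow w_\leftarrow+w_\uparrow w_\rightarrow}\ge r,\qquad \epsilon_\updownarrow w_\downarrow\le w_\uparrow,\quad \epsilon_\updownarrow w_\uparrow\le w_\downarrow,\qquad w_\uparrow\epsilon_\leftrightarrow,\ w_\downarrow\epsilon_\leftrightarrow,\ \epsilon_\leftrightarrow,\ \epsilon_\updownarrow<\tfrac1{12}.$$ -/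

import Mathlib

open Filter Finset
open scoped Matrix

/-- A finite bipartite graph with vertex sets `V₀`, `V₁` and edge set `E ⊆ V₀ × V₁`, together with
an edge-preserving action of the group `G` that is free on `V₀` and on `V₁`. -/
structure FreeBipartiteGraph (G : Type) [Group G] where
  V₀ : Type
  V₁ : Type
  [fintype₀ : Fintype V₀]
  [fintype₁ : Fintype V₁]
  [action₀ : MulAction G V₀]
  [action₁ : MulAction G V₁]
  E : V₀ → V₁ → Prop
  E_smul : ∀ (g : G) (x₀ : V₀) (x₁ : V₁), E x₀ x₁ → E (g • x₀) (g • x₁)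
  free₀ : ∀ (g : G) (x₀ : V₀), g • x₀ = x₀ → g = 1
  free₁ : ∀ (g : G) (x₁ : V₁), g • x₁ = x₁ → g = 1

attribute [instance] FreeBipartiteGraph.fintype₀ FreeBipartiteGraph.fintype₁
  FreeBipartiteGraph.action₀ FreeBipartiteGraph.action₁

section Expansion

variable {A B : Type} [Fintype A] [Fintype B]

open Classical in
/-- The set of vertices of `B` that are adjacent to some vertex of `S ⊆ A`. -/
noncomputable def neighbors (E : A → B → Prop) (S : Finset A) : Finset B :=
  univ.filter fun b => ∃ a ∈ S, E a b

open Classical in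
/-- The bipartite graph is `(w₀, w₁)`-regular. -/
def IsBiregular (E : A → B → Prop) (w₀ w₁ : ℕ) : Prop :=
  (∀ a, #{b | E a b} = w₀) ∧ (∀ b, #{a | E a b} = w₁)

/-- `(c, α)`-vertex expansion from `A` to `B`. -/
def HasVertexExpansion (E : A → B → Prop) (c α : ℝ) : Prop :=
  ∀ S : Finset A, (#S : ℝ) < c * Fintype.card A → α * #S ≤ #(neighbors E S)

/-- A `(w₀, w₁)`-regular bipartite graph that is a 2-sided `(c, ε)`-lossless expander. -/
def IsLosslessExpander (E : A → B → Prop) (w₀ w₁ : ℕ) (c ε : ℝ) : Prop :=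
  IsBiregular E w₀ w₁ ∧
    HasVertexExpansion E c ((1 - ε) * w₀) ∧
    HasVertexExpansion (fun b a => E a b) c ((1 - ε) * w₁)

end Expansion

/-- The conjecture that 2-sided lossless expanders with free group action exist. The intervals are
the nonempty open intervals `(a, b) ⊆ (0, 1)`; `κ₁, κ₂` are the constants of `|V₀| = Θ(|G|)`. -/
def LosslessExpanderConjecture : Prop :=
  ∃ (G : ℕ → Type) (_ : ∀ i, Group (G i)) (_ : ∀ i, Fintype (G i)),
    Tendsto (fun i => Fintype.card (G i)) atTop atTop ∧
    ∀ ε : ℝ, 0 < ε → ∀ a b : ℝ, 0 ≤ a → a < b → b ≤ 1 →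
      ∃ (w₀ w₁ : ℕ) (c κ₁ κ₂ : ℝ) (i₀ : ℕ), 0 < c ∧ 0 < κ₁ ∧
        a < (w₀ : ℝ) / w₁ ∧ (w₀ : ℝ) / w₁ < b ∧
        ∀ i, i₀ ≤ i → ∃ X : FreeBipartiteGraph (G i),
          IsLosslessExpander X.E w₀ w₁ c ε ∧
          κ₁ * Fintype.card (G i) ≤ Fintype.card X.V₀ ∧
          Fintype.card X.V₀ ≤ κ₂ * Fintype.card (G i)

/-- A quantum CSS code, given by the parity-check matrices of its X- and Z-stabilizers. -/
structure CSSCode where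
  Qubit : Type
  XCheck : Type
  ZCheck : Type
  [fintypeQubit : Fintype Qubit]
  [fintypeXCheck : Fintype XCheck]
  [fintypeZCheck : Fintype ZCheck]
  Hx : Matrix XCheck Qubit (ZMod 2)
  Hz : Matrix ZCheck Qubit (ZMod 2)
  commute : Hx * Hzᵀ = 0

attribute [instance] CSSCode.fintypeQubit CSSCode.fintypeXCheck CSSCode.fintypeZCheck

namespace CSSCode

variable (C : CSSCode)

/-- The number `n` of physical qubits. -/
def length : ℕ := Fintype.card C.Qubit

/-- The number `k` of logical qubits: `n - k` is the number of independent stabilizer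
generators. -/
noncomputable def dimension : ℕ := C.length - (C.Hx.rank + C.Hz.rank)

/-- The Pauli string with X-part `a` and Z-part `b` (up to a phase) commutes with all the
stabilizers. -/
def IsLogical (a b : C.Qubit → ZMod 2) : Prop := C.Hz *ᵥ a = 0 ∧ C.Hx *ᵥ b = 0

/-- The Pauli string with X-part `a` and Z-part `b` is (up to a phase) a stabilizer, i.e. a trivial
logical operator. -/
def IsTrivialLogical (a b : C.Qubit → ZMod 2) : Prop :=
  (∃ u : C.XCheck → ZMod 2, u ᵥ* C.Hx = a) ∧ (∃ v : C.ZCheck → ZMod 2, v ᵥ* C.Hz = b)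

/-- The number of qubits on which a Pauli string acts nontrivially. -/
def pauliWeight (a b : C.Qubit → ZMod 2) : ℕ := #{q | a q ≠ 0 ∨ b q ≠ 0}

/-- The distance `d`: the minimal weight of a nontrivial logical operator
(`0` if there is none, i.e. if the code has dimension `0`). -/
noncomputable def distance : ℕ :=
  sInf {d | ∃ a b, C.IsLogical a b ∧ ¬ C.IsTrivialLogical a b ∧ C.pauliWeight a b = d}

/-- The maximal weight of the rows and columns of a matrix. -/
def maxWeight {m n : Type} [Fintype m] [Fintype n] (H : Matrix m n (ZMod 2)) : ℕ :=
  max (univ.sup fun i => hammingNorm fun j => H i j) (univ.sup fun j => hammingNorm fun i => H i j)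

/-- The weight `w` of the code: the maximal weight of all rows and columns of `Hx` and `Hz`. -/
def weight : ℕ := max (maxWeight C.Hx) (maxWeight C.Hz)

end CSSCode

section BalancedProduct

/-- The quotient `A × B / G` by the diagonal action. -/
abbrev BalancedVertex (G A B : Type) [Group G] [MulAction G A] [MulAction G B] : Type :=
  MulAction.orbitRel.Quotient G (A × B)

/-- The class of `(a, b)` in `A × B / G`. -/
abbrev BalancedVertex.mk (G : Type) {A B : Type} [Group G] [MulAction G A] [MulAction G B]
    (a : A) (b : B) : BalancedVertex G A B :=
  Quotient.mk (MulAction.orbitRel G (A × B)) (a, b)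

variable {G : Type} [Group G]

/-- For a graph `E` between `A₀` and `A₁`, the edges between `A₀ × B / G` and `A₁ × B / G`. -/
def verticalEdge {A₀ A₁ : Type} (B : Type) [MulAction G A₀] [MulAction G A₁] [MulAction G B]
    (E : A₀ → A₁ → Prop) (z₀ : BalancedVertex G A₀ B) (z₁ : BalancedVertex G A₁ B) : Prop :=
  ∃ a₀ a₁ b, E a₀ a₁ ∧ z₀ = .mk G a₀ b ∧ z₁ = .mk G a₁ b

/-- For a graph `E` between `B₀` and `B₁`, the edges between `A × B₀ / G` and `A × B₁ / G`. -/
def horizontalEdge (A : Type) {B₀ B₁ : Type} [MulAction G A] [MulAction G B₀] [MulAction G B₁]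
    (E : B₀ → B₁ → Prop) (z₀ : BalancedVertex G A B₀) (z₁ : BalancedVertex G A B₁) : Prop :=
  ∃ a b₀ b₁, E b₀ b₁ ∧ z₀ = .mk G a b₀ ∧ z₁ = .mk G a b₁

open Classical in
/-- The adjacency matrix, as the matrix of the map `𝔽₂^A → 𝔽₂^B` that sends the basis vector of `a`
to the sum of the basis vectors of the neighbors of `a`. -/
noncomputable def adjacency {A B : Type} (E : A → B → Prop) : Matrix B A (ZMod 2) :=
  Matrix.of fun b a => if E a b then 1 else 0

noncomputable instance balancedVertexFintype {A B : Type} [Fintype A] [Fintype B] [MulAction G A] [MulAction G B] :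
    Fintype (BalancedVertex G A B) := Fintype.ofFinite _

variable (X Y : FreeBipartiteGraph G)

/-- The map `∂₂ : 𝔽₂^V₀₀ → 𝔽₂^V₁₀ ⊕ 𝔽₂^V₀₁` of the balanced product `X ×_G Y`, where
`V_αβ = X.V_α × Y.V_β / G`. -/
noncomputable def boundary₂ : Matrix (BalancedVertex G X.V₁ Y.V₀ ⊕ BalancedVertex G X.V₀ Y.V₁)
    (BalancedVertex G X.V₀ Y.V₀) (ZMod 2) :=
  Matrix.fromRows (adjacency (verticalEdge Y.V₀ X.E)) (adjacency (horizontalEdge X.V₀ Y.E))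

/-- The map `∂₁ : 𝔽₂^V₁₀ ⊕ 𝔽₂^V₀₁ → 𝔽₂^V₁₁` of the balanced product `X ×_G Y`. -/
noncomputable def boundary₁ : Matrix (BalancedVertex G X.V₁ Y.V₁)
    (BalancedVertex G X.V₁ Y.V₀ ⊕ BalancedVertex G X.V₀ Y.V₁) (ZMod 2) :=
  Matrix.fromCols (adjacency (horizontalEdge X.V₁ Y.E)) (adjacency (verticalEdge Y.V₁ X.E))

theorem verticalEdge_mk_iff {B : Type} [MulAction G B] (x₀ : X.V₀) (b : B)
    (z : BalancedVertex G X.V₁ B) :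
    verticalEdge B X.E (.mk G x₀ b) z ↔ ∃ x₁, X.E x₀ x₁ ∧ .mk G x₁ b = z := by
  constructor
  · rintro ⟨a₀, a₁, b', h, h0, rfl⟩
    obtain ⟨g, hg⟩ := Quotient.exact h0
    simp only [Prod.smul_mk, Prod.mk.injEq] at hg
    obtain ⟨rfl, rfl⟩ := hg
    exact ⟨g • a₁, X.E_smul g _ _ h, Quotient.sound ⟨g, rfl⟩⟩
  · rintro ⟨x₁, h, rfl⟩
    exact ⟨x₀, x₁, b, h, rfl, rfl⟩

theorem horizontalEdge_mk_iff {A : Type} [MulAction G A] (a : A) (y₀ : Y.V₀)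
    (z : BalancedVertex G A Y.V₁) :
    horizontalEdge A Y.E (.mk G a y₀) z ↔ ∃ y₁, Y.E y₀ y₁ ∧ .mk G a y₁ = z := by
  constructor
  · rintro ⟨a', b₀, b₁, h, h0, rfl⟩
    obtain ⟨g, hg⟩ := Quotient.exact h0
    simp only [Prod.smul_mk, Prod.mk.injEq] at hg
    obtain ⟨rfl, rfl⟩ := hg
    exact ⟨g • b₁, Y.E_smul g _ _ h, Quotient.sound ⟨g, rfl⟩⟩
  · rintro ⟨y₁, h, rfl⟩
    exact ⟨a, y₀, y₁, h, rfl, rfl⟩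

open Classical in
theorem sum_verticalEdge {B : Type} [Fintype B] [MulAction G B]
    (hB : ∀ (g : G) (b : B), g • b = b → g = 1) (x₀ : X.V₀) (b : B)
    (f : BalancedVertex G X.V₁ B → ZMod 2) :
    ∑ z, f z * (if verticalEdge B X.E (.mk G x₀ b) z then 1 else 0) =
      ∑ x₁ with X.E x₀ x₁, f (.mk G x₁ b) := by
  simp only [mul_ite, mul_one, mul_zero, ← Finset.sum_filter]
  symm
  refine Finset.sum_bij (fun x₁ _ => .mk G x₁ b) ?_ ?_ ?_ ?_
  · intro x₁ h
    simp only [Finset.mem_filter, Finset.mem_univ, true_and] at h ⊢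
    exact ⟨x₀, x₁, b, h, rfl, rfl⟩
  · intro x₁ _ x₁' _ h
    obtain ⟨g, hg⟩ := Quotient.exact h
    simp only [Prod.smul_mk, Prod.mk.injEq] at hg
    rw [hB g b hg.2, one_smul] at hg
    exact hg.1.symm
  · intro z hz
    simp only [Finset.mem_filter, Finset.mem_univ, true_and] at hz
    obtain ⟨x₁, h, rfl⟩ := (verticalEdge_mk_iff X x₀ b z).1 hz
    exact ⟨x₁, by simpa using h, rfl⟩
  · intros; rfl

open Classical in
theorem sum_horizontalEdge {A : Type} [Fintype A] [MulAction G A]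
    (hA : ∀ (g : G) (a : A), g • a = a → g = 1) (a : A) (y₀ : Y.V₀)
    (f : BalancedVertex G A Y.V₁ → ZMod 2) :
    ∑ z, f z * (if horizontalEdge A Y.E (.mk G a y₀) z then 1 else 0) =
      ∑ y₁ with Y.E y₀ y₁, f (.mk G a y₁) := by
  simp only [mul_ite, mul_one, mul_zero, ← Finset.sum_filter]
  symm
  refine Finset.sum_bij (fun y₁ _ => .mk G a y₁) ?_ ?_ ?_ ?_
  · intro y₁ h
    simp only [Finset.mem_filter, Finset.mem_univ, true_and] at h ⊢
    exact ⟨a, y₀, y₁, h, rfl, rfl⟩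
  · intro y₁ _ y₁' _ h
    obtain ⟨g, hg⟩ := Quotient.exact h
    simp only [Prod.smul_mk, Prod.mk.injEq] at hg
    have h2 := hg.2
    rw [hA g a hg.1, one_smul] at h2
    exact h2.symm
  · intro z hz
    simp only [Finset.mem_filter, Finset.mem_univ, true_and] at hz
    obtain ⟨y₁, h, rfl⟩ := (horizontalEdge_mk_iff Y a y₀ z).1 hz
    exact ⟨y₁, by simpa using h, rfl⟩
  · intros; rfl

/-- The maps `∂₂`, `∂₁` form a chain complex. -/
theorem boundary₁_mul_boundary₂ : boundary₁ X Y * boundary₂ X Y = 0 := by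
  classical
  rw [boundary₁, boundary₂, Matrix.fromCols_mul_fromRows]
  ext z₁₁ z₀₀
  obtain ⟨⟨x₀, y₀⟩, rfl⟩ := Quotient.exists_rep z₀₀
  have h1 := sum_verticalEdge X Y.free₀ x₀ y₀
    fun z => adjacency (horizontalEdge X.V₁ Y.E) z₁₁ z
  have h2 := sum_horizontalEdge Y X.free₀ x₀ y₀
    fun z => adjacency (verticalEdge Y.V₁ X.E) z₁₁ z
  have h3 : ∀ x₁, adjacency (horizontalEdge X.V₁ Y.E) z₁₁ (.mk G x₁ y₀) =
      ∑ y₁ with Y.E y₀ y₁, if z₁₁ = .mk G x₁ y₁ then 1 else 0 := by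
    intro x₁
    rw [← sum_horizontalEdge Y X.free₁ x₁ y₀ fun z => if z₁₁ = z then 1 else 0]
    simp only [adjacency, Matrix.of_apply, ite_mul, one_mul, zero_mul, Finset.sum_ite_eq,
      Finset.mem_univ, if_true]
  have h4 : ∀ y₁, adjacency (verticalEdge Y.V₁ X.E) z₁₁ (.mk G x₀ y₁) =
      ∑ x₁ with X.E x₀ x₁, if z₁₁ = .mk G x₁ y₁ then 1 else 0 := by
    intro y₁
    rw [← sum_verticalEdge X Y.free₁ x₀ y₁ fun z => if z₁₁ = z then 1 else 0]
    simp only [adjacency, Matrix.of_apply, ite_mul, one_mul, zero_mul, Finset.sum_ite_eq,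
      Finset.mem_univ, if_true]
  simp only [h3] at h1
  simp only [h4] at h2
  rw [Finset.sum_comm] at h2
  rw [Matrix.add_apply, Matrix.mul_apply, Matrix.mul_apply]
  have h := (congrArg₂ (· + ·) h1 h2).trans (CharTwo.add_self_eq_zero _)
  exact h

/-- The CSS code of the balanced product `X ×_G Y`: the vertices in `V₀₀`, in `V₁₀` and `V₀₁`, and
in `V₁₁` are the Z-stabilizers, the qubits, and the X-stabilizers. -/
noncomputable def balancedProductCode : CSSCode where
  Qubit := BalancedVertex G X.V₁ Y.V₀ ⊕ BalancedVertex G X.V₀ Y.V₁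
  XCheck := BalancedVertex G X.V₁ Y.V₁
  ZCheck := BalancedVertex G X.V₀ Y.V₀
  Hx := boundary₁ X Y
  Hz := (boundary₂ X Y)ᵀ
  commute := by rw [Matrix.transpose_transpose]; exact boundary₁_mul_boundary₂ X Y

end BalancedProduct

/-! The codes are balanced products of a graph `X` whose side `V₁` is the larger one and a graph `Y`
whose side `V₀` is the larger one. Then `V₁₀` is much larger than the other three vertex sets, so
there are far more qubits than checks, and counting alone bounds the rate
(`rate_le_dimension_div_length`).

For the distance it must be shown that a cycle of small weight is a boundary. Weigh each qubit by
its number of edges into `V₁₁`, that is `wR` on `V₁₀` and `wD` on `V₀₁`, and replace the cycle by a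
homologous one of least total weight, with supports `S ⊆ V₁₀` and `T ⊆ V₀₁`. By minimality no `z` in
`V₀₀` sees more than half of its weighted neighbourhood in `S` and `T`. By lossless expansion and
the cycle condition, nearly all edges from `S` and `T` end in vertices of `V₁₁` with exactly one
neighbour in `S` and one in `T`. Each such vertex closes a square with some `z`, so nearly half of
the total weight is at most the sum over `z` of the products `a z * b z`, where `a z` and `b z`
count the neighbours of `z` in `S` and `T`. Expansion from `V₀₀` says that the vertices `z` with
many neighbours in `S` and `T` share hardly any of them; together with the minimality bound this
makes the sum too small unless `S` and `T` are empty (`eq_empty_of_locally_minimal`).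

Expansion passes from the factors to the product because, by freeness, the edges in one direction
form disjoint copies of one factor. The other type of logical operator is handled by exchanging the
two sides of both graphs, which transposes the complex.

The conjecture fixes the groups before `ε`, so both factors can share a group although the `ε` of
`Y` depends on the degrees of `X`. -/

/-- `α`-vertex expansion of the sets of fewer than `m` vertices. -/
def SmallSetExpansion {A B : Type} [Fintype B] (E : A → B → Prop) (m α : ℝ) : Prop :=
  ∀ S : Finset A, (#S : ℝ) < m → α * #S ≤ #(neighbors E S)

/-! ### Double counting of edges -/

section Counting

variable {A B : Type}

open Classical in
theorem sum_card_filter_comm (E : A → B → Prop) (S : Finset A) (D : Finset B) :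
    ∑ a ∈ S, #{b ∈ D | E a b} = ∑ b ∈ D, #{a ∈ S | E a b} :=
  Finset.sum_card_bipartiteAbove_eq_sum_card_bipartiteBelow E

variable [Fintype B]

open Classical in
theorem sum_card_left_neighbors (E : A → B → Prop) {w : ℕ} (hE : ∀ a, #{b | E a b} = w)
    (S : Finset A) : ∑ b, #{a ∈ S | E a b} = w * #S := by
  rw [← sum_card_filter_comm, Finset.sum_congr rfl fun a _ => hE a, Finset.sum_const, smul_eq_mul,
    mul_comm]

open Classical in
theorem card_neighbors_eq_sum (E : A → B → Prop) (S : Finset A) :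
    #(neighbors E S) = ∑ b, if 1 ≤ #{a ∈ S | E a b} then 1 else 0 := by
  rw [neighbors, Finset.card_filter]
  refine Finset.sum_congr rfl fun b _ => ?_
  congr 1
  rw [Nat.one_le_iff_ne_zero, Finset.card_ne_zero, eq_iff_iff]
  exact ⟨fun ⟨a, h⟩ => ⟨a, by simpa using h⟩, fun ⟨a, h⟩ => ⟨a, by simpa using h⟩⟩

open Classical in
/-- In a lossless expander the edges between a small set `S` and any set `D` of right vertices
number at most `#D` plus a small excess. -/
theorem sum_card_filter_le (E : A → B → Prop) {w : ℕ} (hE : ∀ a, #{b | E a b} = w) {ε : ℝ}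
    {S : Finset A} (hS : (1 - ε) * w * #S ≤ #(neighbors E S)) (D : Finset B) :
    ∑ a ∈ S, (#{b ∈ D | E a b} : ℝ) ≤ #D + ε * w * #S := by
  have h1 : ∑ a ∈ S, (#{b ∈ D | E a b} : ℝ) = ∑ b ∈ D, (#{a ∈ S | E a b} : ℝ) := by
    exact_mod_cast sum_card_filter_comm E S D
  have h2 : (∑ b, (#{a ∈ S | E a b} : ℝ)) = w * #S := by
    exact_mod_cast sum_card_left_neighbors E hE S
  have h3 : (#(neighbors E S) : ℝ) = ∑ b, if 1 ≤ #{a ∈ S | E a b} then 1 else 0 := by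
    exact_mod_cast card_neighbors_eq_sum E S
  rw [← Finset.sum_add_sum_compl D] at h2 h3
  have h4 : ∑ b ∈ D, (if 1 ≤ #{a ∈ S | E a b} then (1 : ℝ) else 0) ≤ #D := by
    rw [Finset.card_eq_sum_ones, Nat.cast_sum]
    refine Finset.sum_le_sum fun b _ => ?_
    split_ifs <;> simp
  have h5 : ∑ b ∈ Dᶜ, (if 1 ≤ #{a ∈ S | E a b} then (1 : ℝ) else 0) ≤
      ∑ b ∈ Dᶜ, (#{a ∈ S | E a b} : ℝ) := by
    refine Finset.sum_le_sum fun b _ => ?_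
    split_ifs with h
    · exact_mod_cast h
    · positivity
  linarith

end Counting

/-! ### Small locally minimal cycles vanish -/

section LocallyMinimal

open Classical in
/-- If two small sets expand losslessly into the same set of vertices, and every vertex has an even
number of neighbors in their union, then most edges end in a vertex that has a unique neighbor in
each of the two sets. -/
theorem edges_le_two_mul_card_unique {A B C : Type} [Fintype C] (E : A → C → Prop)
    (F : B → C → Prop) {wE wF : ℕ} (hE : ∀ a, #{c | E a c} = wE) (hF : ∀ b, #{c | F b c} = wF)
    {ε ε' : ℝ} {S : Finset A} {T : Finset B} (hS : (1 - ε) * wE * #S ≤ #(neighbors E S))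
    (hT : (1 - ε') * wF * #T ≤ #(neighbors F T))
    (heven : ∀ c, Even (#{a ∈ S | E a c} + #{b ∈ T | F b c})) :
    (wE * #S + wF * #T : ℝ) ≤ 2 * #{c | #{a ∈ S | E a c} = 1 ∧ #{b ∈ T | F b c} = 1} +
      3 * (ε * wE * #S + ε' * wF * #T) := by
  have h1 : (∑ c, (#{a ∈ S | E a c} : ℝ)) = wE * #S := by
    exact_mod_cast sum_card_left_neighbors E hE S
  have h2 : (∑ c, (#{b ∈ T | F b c} : ℝ)) = wF * #T := by
    exact_mod_cast sum_card_left_neighbors F hF T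
  have h3 : (#(neighbors E S) : ℝ) = ∑ c, if 1 ≤ #{a ∈ S | E a c} then 1 else 0 := by
    exact_mod_cast card_neighbors_eq_sum E S
  have h4 : (#(neighbors F T) : ℝ) = ∑ c, if 1 ≤ #{b ∈ T | F b c} then 1 else 0 := by
    exact_mod_cast card_neighbors_eq_sum F T
  have h5 : (#{c | #{a ∈ S | E a c} = 1 ∧ #{b ∈ T | F b c} = 1} : ℝ) =
      ∑ c, if #{a ∈ S | E a c} = 1 ∧ #{b ∈ T | F b c} = 1 then 1 else 0 := by
    rw [Finset.card_filter]; push_cast; rfl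
  -- By parity, outside of `(0, 0)` and `(1, 1)` at least one count is 2 or more, and then the
  -- excess over the indicators is at least half of `x + y`. The factor 3 leaves slack.
  have key : ∀ x y : ℕ, Even (x + y) → (x + y : ℝ) ≤ 2 * (if x = 1 ∧ y = 1 then 1 else 0) +
      3 * ((x - if 1 ≤ x then 1 else 0) + (y - if 1 ≤ y then 1 else 0)) := by
    rintro (_ | _ | x) (_ | _ | y) h
    all_goals first
      | (exfalso; revert h; decide)
      | (simp; try linarith)
  have h6 := Finset.sum_le_sum fun c (_ : c ∈ univ) => key _ _ (heven c)
  simp only [Finset.sum_add_distrib, ← Finset.mul_sum, Finset.sum_sub_distrib] at h6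
  rw [h1, h2, ← h3, ← h4, ← h5] at h6
  linarith

-- The sum of `a z * b z` is split by two thresholds. Where `b` is small, the degree bound on the
-- sum of `a` suffices. Where `b` is large, expansion bounds the sum of `b` by about `#T` instead of
-- `wL * #T`, which settles the `z` with small `a`. Where both are large, the sum of `a` is also
-- about `#S`, and local minimality gains the decisive factor 1/4. In total the sum is at most 6/19
-- of `P + Q`, whereas the edge count requires nearly 1/2.
set_option maxHeartbeats 1000000 in
open Classical in
theorem eq_empty_of_locally_minimal {V₀₀ V₁₀ V₀₁ V₁₁ : Type} [Fintype V₀₀] [Fintype V₁₀]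
    [Fintype V₀₁] [Fintype V₁₁] (v₀ : V₀₀ → V₁₀ → Prop) (h₀ : V₀₀ → V₀₁ → Prop)
    (h₁ : V₁₀ → V₁₁ → Prop) (v₁ : V₀₁ → V₁₁ → Prop) (square : V₀₀ → V₁₀ → V₀₁ → V₁₁ → Prop)
    (hsquare : ∀ q p v, h₁ q v → v₁ p v → ∃ z, v₀ z q ∧ h₀ z p ∧ square z q p v)
    (hunique : ∀ z q p v v', square z q p v → square z q p v' → v = v')
    {wD wU wR wL : ℕ} (hD : 0 < wD) (hU : 0 < wU) (hR : 0 < wR)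
    (hv₀ : IsBiregular v₀ wD wU) (hh₀ : IsBiregular h₀ wR wL)
    (hh₁ : ∀ q, #{v | h₁ q v} = wR) (hv₁ : ∀ p, #{v | v₁ p v} = wD)
    {εV εH m : ℝ} (hεV : 0 ≤ εV) (hεV' : εV ≤ 1 / 400) (hεH : 0 ≤ εH) (hεH' : εH * wU ≤ 1 / 400)
    (ev₀ : SmallSetExpansion v₀ m ((1 - εV) * wD)) (eh₀ : SmallSetExpansion h₀ m ((1 - εH) * wR))
    (eh₁ : SmallSetExpansion h₁ m ((1 - εH) * wR)) (ev₁ : SmallSetExpansion v₁ m ((1 - εV) * wD))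
    (S : Finset V₁₀) (T : Finset V₀₁)
    (heven : ∀ v, Even (#{q ∈ S | h₁ q v} + #{p ∈ T | v₁ p v}))
    (hmin : ∀ z, wR * #{q ∈ S | v₀ z q} + wD * #{p ∈ T | h₀ z p} ≤ wD * wR)
    (hsmall : 20 * wU * (wL + 1) * (wR * #S + wD * #T : ℝ) < m) : S = ∅ ∧ T = ∅ := by
  have hD' : (1 : ℝ) ≤ wD := by exact_mod_cast hD
  have hU' : (1 : ℝ) ≤ wU := by exact_mod_cast hU
  have hR' : (1 : ℝ) ≤ wR := by exact_mod_cast hR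
  have hL' : (0 : ℝ) ≤ wL := by positivity
  obtain ⟨a, ha⟩ : ∃ a : V₀₀ → ℝ, ∀ z, a z = #{q ∈ S | v₀ z q} := ⟨_, fun _ => rfl⟩
  obtain ⟨b, hb⟩ : ∃ b : V₀₀ → ℝ, ∀ z, b z = #{p ∈ T | h₀ z p} := ⟨_, fun _ => rfl⟩
  have ha0 : ∀ z, 0 ≤ a z := fun z => by rw [ha]; positivity
  have hb0 : ∀ z, 0 ≤ b z := fun z => by rw [hb]; positivity
  set P : ℝ := wR * #S with hP
  set Q : ℝ := wD * #T with hQ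
  have hP0 : 0 ≤ P := by positivity
  have hQ0 : 0 ≤ Q := by positivity
  have hSP : (#S : ℝ) ≤ P := le_mul_of_one_le_left (by positivity) hR'
  have hTQ : (#T : ℝ) ≤ Q := le_mul_of_one_le_left (by positivity) hD'
  -- This puts `#S` and `#T` below `m`, so that both sets expand.
  have hW : (P + Q) ≤ 20 * wU * (wL + 1) * (P + Q) := by
    refine le_mul_of_one_le_left (by positivity) ?_
    nlinarith [mul_nonneg (zero_le_one.trans hU') hL']
  have hsuma : ∑ z, a z = wU * #S := by
    have := sum_card_filter_comm v₀ univ S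
    rw [Finset.sum_congr rfl fun q _ => hv₀.2 q, Finset.sum_const, smul_eq_mul, mul_comm] at this
    simp only [ha]
    exact_mod_cast this
  have hsumb : ∑ z, b z = wL * #T := by
    have := sum_card_filter_comm h₀ univ T
    rw [Finset.sum_congr rfl fun q _ => hh₀.2 q, Finset.sum_const, smul_eq_mul, mul_comm] at this
    simp only [hb]
    exact_mod_cast this
  have hsub : ∀ (f : V₀₀ → ℝ) (Z : Finset V₀₀), (∀ z, 0 ≤ f z) → ∑ z ∈ Z, f z ≤ ∑ z, f z :=
    fun f Z hf => Finset.sum_le_sum_of_subset_of_nonneg (subset_univ _) fun z _ _ => hf z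
  -- most of the edges come from squares
  have hT := edges_le_two_mul_card_unique h₁ v₁ hh₁ hv₁ (eh₁ S (by linarith)) (ev₁ T (by linarith))
    heven
  have hcount : (#{v | #{q ∈ S | h₁ q v} = 1 ∧ #{p ∈ T | v₁ p v} = 1} : ℝ) ≤ ∑ z, a z * b z := by
    -- Complete the two edges at `v` to a square. The triple `(z, q, p)` determines `v`, so no
    -- triple is counted twice.
    have : #{v | #{q ∈ S | h₁ q v} = 1 ∧ #{p ∈ T | v₁ p v} = 1} ≤
        #(univ.sigma fun z => ({q ∈ S | v₀ z q} ×ˢ {p ∈ T | h₀ z p} : Finset (V₁₀ × V₀₁))) := by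
      refine Finset.card_le_card_of_forall_subsingleton
        (fun v t => square t.1 t.2.1 t.2.2 v) ?_ ?_
      · intro v hv
        simp only [Finset.mem_filter, Finset.mem_univ, true_and] at hv
        obtain ⟨q, hq⟩ := Finset.card_pos.1 (hv.1.symm ▸ Nat.one_pos)
        obtain ⟨p, hp⟩ := Finset.card_pos.1 (hv.2.symm ▸ Nat.one_pos)
        rw [Finset.mem_filter] at hq hp
        obtain ⟨z, h1, h2, h3⟩ := hsquare q p v hq.2 hp.2
        exact ⟨⟨z, q, p⟩, by simp [hq.1, hp.1, h1, h2], h3⟩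
      · rintro ⟨z, q, p⟩ _ v hv v' hv'
        exact hunique z q p v v' hv.2 hv'.2
    rw [Finset.card_sigma] at this
    simp only [Finset.card_product] at this
    simp only [ha, hb]
    exact_mod_cast this
  -- the vertices with many neighbors in `T`
  set Z : Finset V₀₀ := {z | (wR : ℝ) ≤ 20 * wU * b z} with hZ
  have hZb : (wR : ℝ) * #Z ≤ 20 * wU * ∑ z ∈ Z, b z := by
    rw [Finset.mul_sum, mul_comm, ← nsmul_eq_mul]
    exact Finset.card_nsmul_le_sum _ _ _ fun z hz => (Finset.mem_filter.1 hz).2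
  have hZm : (#Z : ℝ) < m := by
    have h1 : (#Z : ℝ) ≤ wR * #Z := le_mul_of_one_le_left (by positivity) hR'
    have h2 := hsub b Z hb0
    have h3 : 20 * wU * ∑ z ∈ Z, b z ≤ 20 * wU * (wL * #T) := by
      rw [← hsumb]; gcongr
    have h4 : 20 * wU * (wL * #T : ℝ) ≤ 20 * wU * (wL + 1) * (P + Q) := by
      rw [mul_assoc (20 * (wU : ℝ))]
      gcongr
      · linarith
      · linarith
    linarith
  have hbZ := sum_card_filter_le h₀ hh₀.1 (eh₀ Z hZm) T
  simp only [← hb] at hbZ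
  have hbZ' : ∑ z ∈ Z, b z ≤ 20 / 19 * #T := by
    -- The excess `εH * wR * #Z` is absorbed into the left side. The threshold for `Z` contains
    -- `wU`, which is why `εH * wU`, and not just `εH`, has to be small.
    have h1 : εH * (wR * #Z) ≤ εH * (20 * wU * ∑ z ∈ Z, b z) := by gcongr
    have h2 : εH * wU * ∑ z ∈ Z, b z ≤ 1 / 400 * ∑ z ∈ Z, b z := by
      gcongr
      exact Finset.sum_nonneg fun z _ => hb0 z
    linarith
  -- those among them that have also many neighbors in `S`
  set Z' : Finset V₀₀ := {z ∈ Z | (wD : ℝ) ≤ 20 * a z} with hZ'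
  have hZa : (wD : ℝ) * #Z' ≤ 20 * ∑ z ∈ Z', a z := by
    rw [Finset.mul_sum, mul_comm, ← nsmul_eq_mul]
    exact Finset.card_nsmul_le_sum _ _ _ fun z hz => (Finset.mem_filter.1 hz).2
  have hZ'm : (#Z' : ℝ) < m :=
    lt_of_le_of_lt (by exact_mod_cast Finset.card_le_card (Finset.filter_subset _ _)) hZm
  have haZ := sum_card_filter_le v₀ hv₀.1 (ev₀ Z' hZ'm) S
  simp only [← ha] at haZ
  have haZ' : ∑ z ∈ Z', a z ≤ 20 / 19 * #S := by
    have h0 : 0 ≤ ∑ z ∈ Z', a z := Finset.sum_nonneg fun z _ => ha0 z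
    have h1 : εV * (wD * #Z') ≤ εV * (20 * ∑ z ∈ Z', a z) := by gcongr
    have h2 : εV * ∑ z ∈ Z', a z ≤ 1 / 400 * ∑ z ∈ Z', a z := by gcongr
    linarith
  have hbZZ' : ∑ z ∈ Z', b z ≤ ∑ z ∈ Z, b z :=
    Finset.sum_le_sum_of_subset_of_nonneg (Finset.filter_subset _ _) fun z _ _ => hb0 z
  -- the three contributions
  have hlight : ∑ z ∈ Zᶜ, a z * b z ≤ P / 20 := by
    have h1 : ∀ z ∈ Zᶜ, a z * b z ≤ wR / (20 * wU) * a z := by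
      intro z hz
      have : 20 * wU * b z < wR := by simpa [hZ] using hz
      rw [mul_comm]
      refine mul_le_mul_of_nonneg_right ?_ (ha0 z)
      rw [le_div_iff₀ (by positivity)]
      linarith
    refine (Finset.sum_le_sum h1).trans ?_
    rw [← Finset.mul_sum]
    calc wR / (20 * wU) * ∑ z ∈ Zᶜ, a z ≤ wR / (20 * wU) * (wU * #S) := by
          rw [← hsuma]
          exact mul_le_mul_of_nonneg_left (hsub a _ ha0) (by positivity)
      _ = P / 20 := by rw [hP]; field_simp
  have hmid : ∑ z ∈ Z with ¬ (wD : ℝ) ≤ 20 * a z, a z * b z ≤ Q / 19 := by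
    have h1 : ∀ z ∈ ({z ∈ Z | ¬ (wD : ℝ) ≤ 20 * a z} : Finset V₀₀),
        a z * b z ≤ wD / 20 * b z := by
      intro z hz
      have := (Finset.mem_filter.1 hz).2
      refine mul_le_mul_of_nonneg_right ?_ (hb0 z)
      linarith
    refine (Finset.sum_le_sum h1).trans ?_
    rw [← Finset.mul_sum]
    have h2 : ∑ z ∈ Z with ¬ (wD : ℝ) ≤ 20 * a z, b z ≤ ∑ z ∈ Z, b z :=
      Finset.sum_le_sum_of_subset_of_nonneg (Finset.filter_subset _ _) fun z _ _ => hb0 z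
    calc (wD : ℝ) / 20 * ∑ z ∈ Z with ¬ (wD : ℝ) ≤ 20 * a z, b z ≤ wD / 20 * (20 / 19 * #T) := by
          gcongr; exact h2.trans hbZ'
      _ = Q / 19 := by rw [hQ]; ring
  have hheavy : ∑ z ∈ Z', a z * b z ≤ 5 / 19 * (P + Q) := by
    -- AM-GM: the product of `wR * a` and `wD * b` is at most a quarter of the square of their sum,
    -- and one factor of that square is at most `wD * wR` by local minimality.
    have h1 : ∀ z ∈ Z', a z * b z ≤ wR / 4 * a z + wD / 4 * b z := by
      intro z _
      have h : wR * a z + wD * b z ≤ wD * wR := by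
        rw [ha, hb]; exact_mod_cast hmin z
      have hM : (0 : ℝ) < wD * wR := by positivity
      have hN : 0 ≤ wR * a z + wD * b z := by have := ha0 z; have := hb0 z; positivity
      refine le_of_mul_le_mul_left ?_ hM
      nlinarith [sq_nonneg (wR * a z - wD * b z), mul_le_mul_of_nonneg_left h hN]
    refine (Finset.sum_le_sum h1).trans ?_
    rw [Finset.sum_add_distrib, ← Finset.mul_sum, ← Finset.mul_sum]
    calc wR / 4 * ∑ z ∈ Z', a z + wD / 4 * ∑ z ∈ Z', b z
        ≤ wR / 4 * (20 / 19 * #S) + wD / 4 * (20 / 19 * #T) := by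
          gcongr; exact hbZZ'.trans hbZ'
      _ = 5 / 19 * (P + Q) := by rw [hP, hQ]; ring
  have htotal : ∑ z, a z * b z = ∑ z ∈ Z', a z * b z +
      ∑ z ∈ Z with ¬ (wD : ℝ) ≤ 20 * a z, a z * b z + ∑ z ∈ Zᶜ, a z * b z := by
    rw [hZ', Finset.sum_filter_add_sum_filter_not, Finset.sum_add_sum_compl]
  have hεH1 : εH ≤ 1 / 400 := (le_mul_of_one_le_right hεH hU').trans hεH'
  have h1 : εH * P ≤ 1 / 400 * P := by gcongr
  have h2 : εV * Q ≤ 1 / 400 * Q := by gcongr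
  rw [mul_assoc εH, mul_assoc εV, ← hP, ← hQ] at hT
  have hS0 : (#S : ℝ) ≤ 0 := by linarith
  have hT0 : (#T : ℝ) ≤ 0 := by linarith
  exact ⟨Finset.card_eq_zero.1 (by exact_mod_cast hS0.antisymm (by positivity)),
    Finset.card_eq_zero.1 (by exact_mod_cast hT0.antisymm (by positivity))⟩

end LocallyMinimal

/-! ### Disjoint unions of copies of a graph -/

section Fibration

variable {O B₀ B₁ V₀ V₁ : Type} [Fintype O] [Fintype B₀]

open Classical in
theorem card_eq_sum_card_fiber (e : O × B₀ ≃ V₀) (S : Finset V₀) :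
    #S = ∑ o, #{b | e (o, b) ∈ S} := by
  rw [← Finset.card_sigma]
  refine (Finset.card_bij (fun t _ => e (t.1, t.2)) ?_ ?_ ?_).symm
  · rintro ⟨o, b⟩ h
    simpa using h
  · rintro ⟨o, b⟩ _ ⟨o', b'⟩ _ h
    simpa using h
  · intro v hv
    exact ⟨⟨(e.symm v).1, (e.symm v).2⟩, by simpa using hv, by simp⟩

variable [Fintype B₁] [Fintype V₁] {E : B₀ → B₁ → Prop} {R : V₀ → V₁ → Prop} (e₀ : O × B₀ ≃ V₀) (e₁ : O × B₁ ≃ V₁)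

/-- A graph that is a disjoint union of copies of `E` inherits the expansion of `E`. -/
theorem SmallSetExpansion.of_fibration
    (hR : ∀ o b o' b', R (e₀ (o, b)) (e₁ (o', b')) ↔ o = o' ∧ E b b') {m α : ℝ}
    (h : SmallSetExpansion E m α) : SmallSetExpansion R m α := by
  classical
  intro S hS
  have hN : ∀ o, ({b' | e₁ (o, b') ∈ neighbors R S} : Finset B₁) =
      neighbors E {b | e₀ (o, b) ∈ S} := by
    intro o
    ext b'
    simp only [neighbors, Finset.mem_filter, Finset.mem_univ, true_and]
    constructor
    · rintro ⟨v, hv, hR'⟩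
      obtain ⟨⟨o', b⟩, rfl⟩ := e₀.surjective v
      obtain ⟨rfl, hE⟩ := (hR _ _ _ _).1 hR'
      exact ⟨b, hv, hE⟩
    · rintro ⟨b, hb, hE⟩
      exact ⟨_, hb, (hR _ _ _ _).2 ⟨rfl, hE⟩⟩
  rw [card_eq_sum_card_fiber e₀ S, card_eq_sum_card_fiber e₁ (neighbors R S)]
  push_cast
  rw [Finset.mul_sum]
  refine Finset.sum_le_sum fun o _ => ?_
  rw [hN]
  -- The threshold `m` is an absolute size, so every fibre of `S` inherits it; a threshold relative
  -- to the number of vertices would not pass to the fibres.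
  refine h _ (lt_of_le_of_lt ?_ hS)
  rw [card_eq_sum_card_fiber e₀ S]
  exact_mod_cast Finset.single_le_sum (f := fun o => #{b | e₀ (o, b) ∈ S})
    (fun _ _ => Nat.zero_le _) (Finset.mem_univ o)

omit [Fintype O] in
theorem IsBiregular.of_fibration [Fintype V₀]
    (hR : ∀ o b o' b', R (e₀ (o, b)) (e₁ (o', b')) ↔ o = o' ∧ E b b') {w₀ w₁ : ℕ}
    (h : IsBiregular E w₀ w₁) : IsBiregular R w₀ w₁ := by
  classical
  constructor
  · intro v
    obtain ⟨⟨o, b⟩, rfl⟩ := e₀.surjective v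
    rw [← h.1 b]
    refine (Finset.card_bij (fun b' _ => e₁ (o, b')) ?_ ?_ ?_).symm
    · intro b' hb
      simpa [hR] using hb
    · intro b' _ b'' _ hb
      simpa using hb
    · intro v hv
      obtain ⟨⟨o', b'⟩, rfl⟩ := e₁.surjective v
      simp only [Finset.mem_filter, Finset.mem_univ, true_and, hR] at hv
      obtain ⟨rfl, hv⟩ := hv
      exact ⟨b', by simpa using hv, rfl⟩
  · intro v
    obtain ⟨⟨o, b⟩, rfl⟩ := e₁.surjective v
    rw [← h.2 b]
    refine (Finset.card_bij (fun b' _ => e₀ (o, b')) ?_ ?_ ?_).symm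
    · intro b' hb
      simpa [hR] using hb
    · intro b' _ b'' _ hb
      simpa using hb
    · intro v hv
      obtain ⟨⟨o', b'⟩, rfl⟩ := e₀.surjective v
      simp only [Finset.mem_filter, Finset.mem_univ, true_and, hR] at hv
      obtain ⟨rfl, hv⟩ := hv
      exact ⟨b', by simpa using hv, rfl⟩

end Fibration

/-! ### Balanced products as disjoint unions of copies of a factor -/

section BalancedVertices

variable {G : Type} [Group G] {A B : Type} [MulAction G A] [MulAction G B]

theorem BalancedVertex.mk_eq_mk {a a' : A} {b b' : B} :
    BalancedVertex.mk G a b = .mk G a' b' ↔ ∃ g : G, g • a' = a ∧ g • b' = b := by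
  constructor
  · intro h
    obtain ⟨g, hg⟩ := Quotient.exact h
    simp only [Prod.smul_mk, Prod.mk.injEq] at hg
    exact ⟨g, hg⟩
  · rintro ⟨g, rfl, rfl⟩
    exact Quotient.sound ⟨g, rfl⟩

theorem BalancedVertex.mk_left_injective (hB : ∀ (g : G) (b : B), g • b = b → g = 1) {a a' : A}
    {b : B} (h : BalancedVertex.mk G a b = .mk G a' b) : a = a' := by
  obtain ⟨g, rfl, hg⟩ := BalancedVertex.mk_eq_mk.1 h
  rw [hB g b hg, one_smul]

theorem BalancedVertex.mk_right_injective (hA : ∀ (g : G) (a : A), g • a = a → g = 1) {a : A}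
    {b b' : B} (h : BalancedVertex.mk G a b = .mk G a b') : b = b' := by
  obtain ⟨g, hg, rfl⟩ := BalancedVertex.mk_eq_mk.1 h
  rw [hA g a hg, one_smul]

variable (B) in
/-- If `G` acts freely on `A`, then `A × B / G` consists of one copy of `B` for every orbit
of `A`. -/
noncomputable def horizontalFibration (hA : ∀ (g : G) (a : A), g • a = a → g = 1) :
    MulAction.orbitRel.Quotient G A × B ≃ BalancedVertex G A B :=
  Equiv.ofBijective (fun t => .mk G t.1.out t.2) <| by
    constructor
    · rintro ⟨o, b⟩ ⟨o', b'⟩ h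
      have ho : o = o' := by
        obtain ⟨g, hg, -⟩ := BalancedVertex.mk_eq_mk.1 h
        rw [← o.out_eq, ← o'.out_eq]
        exact Quotient.sound ⟨g, hg⟩
      subst ho
      exact Prod.ext rfl (BalancedVertex.mk_right_injective hA h)
    · intro z
      obtain ⟨⟨a, b⟩, rfl⟩ := Quotient.exists_rep z
      obtain ⟨g, hg⟩ : ∃ g : G, g • a = (Quotient.mk (MulAction.orbitRel G A) a).out :=
        Quotient.exact (Quotient.out_eq (Quotient.mk (MulAction.orbitRel G A) a))
      exact ⟨(Quotient.mk (MulAction.orbitRel G A) a, g • b),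
        BalancedVertex.mk_eq_mk.2 ⟨g, hg, rfl⟩⟩

variable (A) in
/-- If `G` acts freely on `B`, then `A × B / G` consists of one copy of `A` for every orbit
of `B`. -/
noncomputable def verticalFibration (hB : ∀ (g : G) (b : B), g • b = b → g = 1) :
    MulAction.orbitRel.Quotient G B × A ≃ BalancedVertex G A B :=
  Equiv.ofBijective (fun t => .mk G t.2 t.1.out) <| by
    constructor
    · rintro ⟨o, b⟩ ⟨o', b'⟩ h
      have ho : o = o' := by
        obtain ⟨g, -, hg⟩ := BalancedVertex.mk_eq_mk.1 h
        rw [← o.out_eq, ← o'.out_eq]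
        exact Quotient.sound ⟨g, hg⟩
      subst ho
      exact Prod.ext rfl (BalancedVertex.mk_left_injective hB h)
    · intro z
      obtain ⟨⟨a, b⟩, rfl⟩ := Quotient.exists_rep z
      obtain ⟨g, hg⟩ : ∃ g : G, g • b = (Quotient.mk (MulAction.orbitRel G B) b).out :=
        Quotient.exact (Quotient.out_eq (Quotient.mk (MulAction.orbitRel G B) b))
      exact ⟨(Quotient.mk (MulAction.orbitRel G B) b, g • a),
        BalancedVertex.mk_eq_mk.2 ⟨g, rfl, hg⟩⟩

/-- Every orbit of `A` has as many elements as `G` and contributes one copy of `B`. -/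
theorem card_balancedVertex_mul_card [Fintype G] [Fintype A] [Fintype B]
    (hA : ∀ (g : G) (a : A), g • a = a → g = 1) :
    Fintype.card (BalancedVertex G A B) * Fintype.card G = Fintype.card A * Fintype.card B := by
  classical
  have h1 := Fintype.card_congr (horizontalFibration B hA)
  have hstab : ∀ a : A, MulAction.stabilizer G a = ⊥ := fun a =>
    (Subgroup.eq_bot_iff_forall _).2 fun g hg => hA g a hg
  have h2 := Fintype.card_congr (MulAction.selfEquivOrbitsQuotientProd hstab)
  rw [Fintype.card_prod] at h1 h2
  rw [← h1, h2]
  change Fintype.card (Quotient (MulAction.orbitRel G A)) * _ * _ = _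
  ring

variable (X Y : FreeBipartiteGraph G)

theorem horizontalEdge_fibration (hA : ∀ (g : G) (a : A), g • a = a → g = 1)
    (o : MulAction.orbitRel.Quotient G A) (y₀ : Y.V₀) (o' : MulAction.orbitRel.Quotient G A)
    (y₁ : Y.V₁) : horizontalEdge A Y.E (horizontalFibration Y.V₀ hA (o, y₀))
      (horizontalFibration Y.V₁ hA (o', y₁)) ↔ o = o' ∧ Y.E y₀ y₁ := by
  refine (horizontalEdge_mk_iff Y _ _ _).trans ?_
  constructor
  · rintro ⟨y, hE, h⟩
    have h' : horizontalFibration Y.V₁ hA (o, y) = horizontalFibration Y.V₁ hA (o', y₁) := h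
    simp only [EmbeddingLike.apply_eq_iff_eq, Prod.mk.injEq] at h'
    obtain ⟨rfl, rfl⟩ := h'
    exact ⟨rfl, hE⟩
  · rintro ⟨rfl, hE⟩
    exact ⟨y₁, hE, rfl⟩

theorem verticalEdge_fibration (hB : ∀ (g : G) (b : B), g • b = b → g = 1)
    (o : MulAction.orbitRel.Quotient G B) (x₀ : X.V₀) (o' : MulAction.orbitRel.Quotient G B)
    (x₁ : X.V₁) : verticalEdge B X.E (verticalFibration X.V₀ hB (o, x₀))
      (verticalFibration X.V₁ hB (o', x₁)) ↔ o = o' ∧ X.E x₀ x₁ := by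
  refine (verticalEdge_mk_iff X _ _ _).trans ?_
  constructor
  · rintro ⟨x, hE, h⟩
    have h' : verticalFibration X.V₁ hB (o, x) = verticalFibration X.V₁ hB (o', x₁) := h
    simp only [EmbeddingLike.apply_eq_iff_eq, Prod.mk.injEq] at h'
    obtain ⟨rfl, rfl⟩ := h'
    exact ⟨rfl, hE⟩
  · rintro ⟨rfl, hE⟩
    exact ⟨x₁, hE, rfl⟩

variable [Fintype A] [Fintype B]

theorem isBiregular_horizontalEdge (hA : ∀ (g : G) (a : A), g • a = a → g = 1) {w₀ w₁ : ℕ}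
    (h : IsBiregular Y.E w₀ w₁) : IsBiregular (horizontalEdge (G := G) A Y.E) w₀ w₁ := by
  classical
  exact h.of_fibration _ _ (horizontalEdge_fibration Y hA)

theorem isBiregular_verticalEdge (hB : ∀ (g : G) (b : B), g • b = b → g = 1) {w₀ w₁ : ℕ}
    (h : IsBiregular X.E w₀ w₁) : IsBiregular (verticalEdge (G := G) B X.E) w₀ w₁ := by
  classical
  exact h.of_fibration _ _ (verticalEdge_fibration X hB)

theorem smallSetExpansion_horizontalEdge (hA : ∀ (g : G) (a : A), g • a = a → g = 1) {m α : ℝ}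
    (h : SmallSetExpansion Y.E m α) : SmallSetExpansion (horizontalEdge (G := G) A Y.E) m α := by
  classical
  exact h.of_fibration _ _ (horizontalEdge_fibration Y hA)

theorem smallSetExpansion_verticalEdge (hB : ∀ (g : G) (b : B), g • b = b → g = 1) {m α : ℝ}
    (h : SmallSetExpansion X.E m α) : SmallSetExpansion (verticalEdge (G := G) B X.E) m α := by
  classical
  exact h.of_fibration _ _ (verticalEdge_fibration X hB)

end BalancedVertices

/-! ### Squares of the balanced product -/

section Squares

variable {G : Type} [Group G] (X Y : FreeBipartiteGraph G)

/-- The four vertices span a square of the balanced product. -/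
def IsBalancedSquare (z : BalancedVertex G X.V₀ Y.V₀) (q : BalancedVertex G X.V₁ Y.V₀)
    (p : BalancedVertex G X.V₀ Y.V₁) (v : BalancedVertex G X.V₁ Y.V₁) : Prop :=
  ∃ x₀ x₁ y₀ y₁, z = .mk G x₀ y₀ ∧ q = .mk G x₁ y₀ ∧ p = .mk G x₀ y₁ ∧ v = .mk G x₁ y₁

variable {X Y}

/-- Translate by a group element until both edges have the same representative of `v`; the missing
corner is then read off from the coordinates. -/
theorem exists_square {q : BalancedVertex G X.V₁ Y.V₀} {p : BalancedVertex G X.V₀ Y.V₁}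
    {v : BalancedVertex G X.V₁ Y.V₁} (hq : horizontalEdge X.V₁ Y.E q v)
    (hp : verticalEdge Y.V₁ X.E p v) : ∃ z, verticalEdge Y.V₀ X.E z q ∧
      horizontalEdge X.V₀ Y.E z p ∧ IsBalancedSquare X Y z q p v := by
  obtain ⟨a, y₀, y₁, hE, rfl, rfl⟩ := hq
  obtain ⟨x₀, x₁, b, hE', rfl, h⟩ := hp
  obtain ⟨g, rfl, rfl⟩ := BalancedVertex.mk_eq_mk.1 h
  have hp : BalancedVertex.mk G x₀ b = .mk G (g • x₀) (g • b) :=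
    (BalancedVertex.mk_eq_mk.2 ⟨g, rfl, rfl⟩).symm
  exact ⟨.mk G (g • x₀) y₀, ⟨_, _, _, X.E_smul g _ _ hE', rfl, rfl⟩, ⟨_, _, _, hE, rfl, hp⟩,
    _, _, _, _, rfl, rfl, hp, rfl⟩

/-- Once a representative of `z` is fixed, freeness leaves a single choice for each of the other two
coordinates. -/
theorem square_unique {z : BalancedVertex G X.V₀ Y.V₀} {q : BalancedVertex G X.V₁ Y.V₀}
    {p : BalancedVertex G X.V₀ Y.V₁} {v v' : BalancedVertex G X.V₁ Y.V₁}
    (h : IsBalancedSquare X Y z q p v) (h' : IsBalancedSquare X Y z q p v') : v = v' := by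
  obtain ⟨x₀, x₁, y₀, y₁, rfl, rfl, rfl, rfl⟩ := h
  obtain ⟨a₀, a₁, b₀, b₁, hz, hq, hp, rfl⟩ := h'
  obtain ⟨g, rfl, rfl⟩ := BalancedVertex.mk_eq_mk.1 hz
  have hq' : BalancedVertex.mk G a₁ b₀ = .mk G (g • a₁) (g • b₀) :=
    (BalancedVertex.mk_eq_mk.2 ⟨g, rfl, rfl⟩).symm
  have hp' : BalancedVertex.mk G a₀ b₁ = .mk G (g • a₀) (g • b₁) :=
    (BalancedVertex.mk_eq_mk.2 ⟨g, rfl, rfl⟩).symm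
  obtain rfl := BalancedVertex.mk_left_injective Y.free₀ (hq.trans hq')
  obtain rfl := BalancedVertex.mk_right_injective X.free₀ (hp.trans hp')
  exact BalancedVertex.mk_eq_mk.2 ⟨g, rfl, rfl⟩

end Squares

/-! ### Supports of vectors over `ZMod 2` -/

section Flip

-- Over `ZMod 2`, adding an indicator replaces the support by a symmetric difference.
open Classical in
theorem card_support_add_indicator {ι : Type} [Fintype ι] (f : ι → ZMod 2) (N : ι → Prop) :
    #{i | f i + (if N i then 1 else 0) ≠ 0} + 2 * #{i | f i ≠ 0 ∧ N i} =
      #{i | f i ≠ 0} + #{i | N i} := by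
  simp only [Finset.card_filter]
  rw [Finset.mul_sum, ← Finset.sum_add_distrib, ← Finset.sum_add_distrib]
  refine Finset.sum_congr rfl fun i _ => ?_
  have key : ∀ x : ZMod 2, x = 0 ∨ x = 1 := by decide
  have h2 : (1 + 1 : ZMod 2) = 0 := by decide
  by_cases hN : N i <;> rcases key (f i) with h | h <;> simp [hN, h, h2]

open Classical in
theorem sum_indicator_mul_eq_card {ι : Type} [Fintype ι] (f : ι → ZMod 2) (N : ι → Prop) :
    ∑ i, (if N i then 1 else 0) * f i = (#{i ∈ ({i | f i ≠ 0} : Finset ι) | N i} : ZMod 2) := by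
  rw [Finset.filter_filter, Finset.card_filter, Nat.cast_sum]
  refine Finset.sum_congr rfl fun i _ => ?_
  have key : ∀ x : ZMod 2, x = 0 ∨ x = 1 := by decide
  by_cases hN : N i <;> rcases key (f i) with h | h <;> simp [hN, h]

end Flip

/-! ### Small cycles are boundaries, small cocycles are coboundaries -/

section Homology

variable {G : Type} [Group G]

-- A representative of least weight `φ` in the homology class of `c` is locally minimal and still
-- small, hence zero.
open Classical in
theorem exists_boundary₂_mulVec_eq (X Y : FreeBipartiteGraph G) {wD wU wR wL : ℕ} (hD : 0 < wD)
    (hU : 0 < wU) (hR : 0 < wR) (hX : IsBiregular X.E wD wU) (hY : IsBiregular Y.E wR wL)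
    {εV εH m : ℝ} (hεV : 0 ≤ εV) (hεV' : εV ≤ 1 / 400) (hεH : 0 ≤ εH) (hεH' : εH * wU ≤ 1 / 400)
    (eX : SmallSetExpansion X.E m ((1 - εV) * wD)) (eY : SmallSetExpansion Y.E m ((1 - εH) * wR))
    (c : BalancedVertex G X.V₁ Y.V₀ ⊕ BalancedVertex G X.V₀ Y.V₁ → ZMod 2)
    (hc : boundary₁ X Y *ᵥ c = 0)
    (hsmall : 20 * wU * (wL + 1) * (wR + wD) * (hammingNorm c : ℝ) < m) :
    ∃ v, boundary₂ X Y *ᵥ v = c := by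
  -- With these weights the two parts of the boundary of a vertex of `V₀₀`, with `wD` and `wR`
  -- elements, both weigh `wD * wR`.
  set φ : (BalancedVertex G X.V₁ Y.V₀ ⊕ BalancedVertex G X.V₀ Y.V₁ → ZMod 2) → ℕ := fun c =>
    wR * #{q | c (.inl q) ≠ 0} + wD * #{p | c (.inr p) ≠ 0} with hφ
  obtain ⟨v, hv⟩ := Finite.exists_min fun v => φ (c + boundary₂ X Y *ᵥ v)
  set c' := c + boundary₂ X Y *ᵥ v with hc'
  have hcycle : boundary₁ X Y *ᵥ c' = 0 := by
    rw [hc', Matrix.mulVec_add, hc, Matrix.mulVec_mulVec, boundary₁_mul_boundary₂,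
      Matrix.zero_mulVec, add_zero]
  have hnorm : φ c' ≤ (wR + wD) * hammingNorm c := by
    have h0 := hv 0
    simp only [Matrix.mulVec_zero, add_zero] at h0
    refine h0.trans ?_
    have hl : #{q | c (.inl q) ≠ 0} ≤ hammingNorm c :=
      Finset.card_le_card_of_injOn Sum.inl (fun q hq => by simpa using hq)
        Sum.inl_injective.injOn
    have hr : #{p | c (.inr p) ≠ 0} ≤ hammingNorm c :=
      Finset.card_le_card_of_injOn Sum.inr (fun q hq => by simpa using hq)
        Sum.inr_injective.injOn
    rw [add_mul]
    exact add_le_add (Nat.mul_le_mul_left _ hl) (Nat.mul_le_mul_left _ hr)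
  have hv₀ := isBiregular_verticalEdge (B := Y.V₀) X Y.free₀ hX
  have hh₀ := isBiregular_horizontalEdge (A := X.V₀) Y X.free₀ hY
  have hmain := eq_empty_of_locally_minimal (m := m) (verticalEdge Y.V₀ X.E)
    (horizontalEdge X.V₀ Y.E) (horizontalEdge X.V₁ Y.E) (verticalEdge Y.V₁ X.E)
    (IsBalancedSquare X Y) (fun q p v => exists_square) (fun z q p v v' => square_unique)
    hD hU hR hv₀ hh₀ (isBiregular_horizontalEdge (A := X.V₁) Y X.free₁ hY).1
    (isBiregular_verticalEdge (B := Y.V₁) X Y.free₁ hX).1 hεV hεV' hεH hεH'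
    (smallSetExpansion_verticalEdge X Y.free₀ eX) (smallSetExpansion_horizontalEdge Y X.free₀ eY)
    (smallSetExpansion_horizontalEdge Y X.free₁ eY) (smallSetExpansion_verticalEdge X Y.free₁ eX)
    {q | c' (.inl q) ≠ 0} {p | c' (.inr p) ≠ 0} ?_ ?_ ?_
  · refine ⟨-v, ?_⟩
    have h0 : c' = 0 := by
      funext i
      rcases i with q | p
      · by_contra h
        exact Finset.eq_empty_iff_forall_notMem.1 hmain.1 q (by simpa using h)
      · by_contra h
        exact Finset.eq_empty_iff_forall_notMem.1 hmain.2 p (by simpa using h)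
    rw [Matrix.mulVec_neg]
    exact (eq_neg_of_add_eq_zero_left h0).symm
  · intro u
    have h := congrFun hcycle u
    rw [boundary₁, Matrix.fromCols_mulVec] at h
    simp only [Pi.add_apply, Matrix.mulVec, dotProduct, adjacency, Matrix.of_apply,
      Function.comp_apply, Pi.zero_apply] at h
    rw [sum_indicator_mul_eq_card (fun q => c' (.inl q)),
      sum_indicator_mul_eq_card (fun p => c' (.inr p)), ← Nat.cast_add,
      ZMod.natCast_eq_zero_iff_even] at h
    exact h
  · intro z
    -- Flipping the boundary of `z`, of weight `2 * wD * wR`, does not lower `φ`, so at most half of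
    -- that weight lies in the support of `c'`.
    have h0 := hv (v + Pi.single z 1)
    have hz : c + boundary₂ X Y *ᵥ (v + Pi.single z 1) = fun i => c' i +
        Sum.elim (fun q => if verticalEdge Y.V₀ X.E z q then 1 else 0)
          (fun p => if horizontalEdge X.V₀ Y.E z p then 1 else 0) i := by
      rw [Matrix.mulVec_add, ← add_assoc, ← hc', Matrix.mulVec_single_one]
      funext i
      rcases i with q | p <;> rfl
    have h := h0.trans_eq (congrArg φ hz)
    change _ ≤ wR * #{q | (c' (.inl q) + if verticalEdge Y.V₀ X.E z q then 1 else 0) ≠ 0} +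
      wD * #{p | (c' (.inr p) + if horizontalEdge X.V₀ Y.E z p then 1 else 0) ≠ 0} at h
    change wR * #{q | c' (.inl q) ≠ 0} + wD * #{p | c' (.inr p) ≠ 0} ≤ _ at h
    have h1 := card_support_add_indicator (fun q => c' (.inl q)) (verticalEdge Y.V₀ X.E z)
    have h2 := card_support_add_indicator (fun p => c' (.inr p)) (horizontalEdge X.V₀ Y.E z)
    rw [hv₀.1 z] at h1
    rw [hh₀.1 z] at h2
    rw [Finset.filter_filter, Finset.filter_filter]
    have h3 := congrArg (wR * ·) h1
    have h4 := congrArg (wD * ·) h2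
    simp only [mul_add] at h3 h4
    rw [mul_comm wR wD] at h3
    linarith
  · refine lt_of_le_of_lt ?_ hsmall
    rw [mul_assoc (20 * (wU : ℝ) * (wL + 1))]
    gcongr
    exact_mod_cast hnorm

/-- The bipartite graph with the two sides exchanged. -/
abbrev FreeBipartiteGraph.swap (X : FreeBipartiteGraph G) : FreeBipartiteGraph G where
  V₀ := X.V₁
  V₁ := X.V₀
  E x₁ x₀ := X.E x₀ x₁
  E_smul g x₁ x₀ := X.E_smul g x₀ x₁
  free₀ := X.free₁
  free₁ := X.free₀

theorem verticalEdge_swap (X : FreeBipartiteGraph G) {B : Type} [MulAction G B]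
    (z₀ : BalancedVertex G X.V₀ B) (z₁ : BalancedVertex G X.V₁ B) :
    verticalEdge B X.swap.E z₁ z₀ ↔ verticalEdge B X.E z₀ z₁ :=
  ⟨fun ⟨a₁, a₀, b, h, h1, h0⟩ => ⟨a₀, a₁, b, h, h0, h1⟩,
    fun ⟨a₀, a₁, b, h, h0, h1⟩ => ⟨a₁, a₀, b, h, h1, h0⟩⟩

theorem horizontalEdge_swap (Y : FreeBipartiteGraph G) {A : Type} [MulAction G A]
    (z₀ : BalancedVertex G A Y.V₀) (z₁ : BalancedVertex G A Y.V₁) :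
    horizontalEdge A Y.swap.E z₁ z₀ ↔ horizontalEdge A Y.E z₀ z₁ :=
  ⟨fun ⟨a, b₁, b₀, h, h1, h0⟩ => ⟨a, b₀, b₁, h, h0, h1⟩,
    fun ⟨a, b₀, b₁, h, h0, h1⟩ => ⟨a, b₁, b₀, h, h1, h0⟩⟩

-- Exchanging the sides of both factors swaps `V₀₀` with `V₁₁` and `V₁₀` with `V₀₁`, which turns the
-- complex into its transpose.
open Classical in
theorem boundary₁_swap (X Y : FreeBipartiteGraph G) :
    boundary₁ X.swap Y.swap = (boundary₂ X Y)ᵀ.submatrix id Sum.swap := by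
  ext z i
  rcases i with p | q
  · exact if_congr (horizontalEdge_swap Y z p) rfl rfl
  · exact if_congr (verticalEdge_swap X z q) rfl rfl

open Classical in
theorem boundary₂_swap (X Y : FreeBipartiteGraph G) :
    boundary₂ X.swap Y.swap = (boundary₁ X Y)ᵀ.submatrix Sum.swap id := by
  ext i v
  rcases i with p | q
  · exact if_congr (verticalEdge_swap X p v) rfl rfl
  · exact if_congr (horizontalEdge_swap Y q v) rfl rfl

-- This is the homological statement for the swapped graphs. The roles of `wD` and `wU` are
-- exchanged, so now `εH * wD` has to be small.
open Classical in
theorem exists_vecMul_boundary₁_eq (X Y : FreeBipartiteGraph G) {wD wU wR wL : ℕ} (hD : 0 < wD)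
    (hU : 0 < wU) (hL : 0 < wL) (hX : IsBiregular X.E wD wU) (hY : IsBiregular Y.E wR wL)
    {εV εH m : ℝ} (hεV : 0 ≤ εV) (hεV' : εV ≤ 1 / 400) (hεH : 0 ≤ εH) (hεH' : εH * wD ≤ 1 / 400)
    (eX : SmallSetExpansion X.swap.E m ((1 - εV) * wU))
    (eY : SmallSetExpansion Y.swap.E m ((1 - εH) * wL))
    (c : BalancedVertex G X.V₁ Y.V₀ ⊕ BalancedVertex G X.V₀ Y.V₁ → ZMod 2)
    (hc : (boundary₂ X Y)ᵀ *ᵥ c = 0)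
    (hsmall : 20 * wD * (wR + 1) * (wL + wU) * (hammingNorm c : ℝ) < m) :
    ∃ u, u ᵥ* boundary₁ X Y = c := by
  have hcycle : boundary₁ X.swap Y.swap *ᵥ (c ∘ Sum.swap) = 0 := by
    rw [boundary₁_swap]
    funext z
    refine Eq.trans ?_ (congrFun hc z)
    simp only [Matrix.mulVec, dotProduct, Matrix.submatrix_apply, Function.comp_apply, id]
    exact (Equiv.sumComm _ _).sum_comp fun i => (boundary₂ X Y)ᵀ z i * c i
  have hnorm : hammingNorm (c ∘ Sum.swap) ≤ hammingNorm c :=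
    Finset.card_le_card_of_injOn Sum.swap (fun q hq => by simpa using hq)
      (Equiv.sumComm _ _).injective.injOn
  obtain ⟨u, hu⟩ := exists_boundary₂_mulVec_eq X.swap Y.swap hU hD hL ⟨hX.2, hX.1⟩ ⟨hY.2, hY.1⟩
    hεV hεV' hεH hεH' eX eY (c ∘ Sum.swap) hcycle (lt_of_le_of_lt (by gcongr) hsmall)
  refine ⟨u, ?_⟩
  funext i
  have h := congrFun hu (Sum.swap i)
  rw [boundary₂_swap, Function.comp_apply, Sum.swap_swap] at h
  rw [← Matrix.mulVec_transpose, ← h]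
  simp only [Matrix.mulVec, dotProduct, Matrix.submatrix_apply, Sum.swap_swap, id]

end Homology

/-! ### Weight of the code -/

section Weight

theorem hammingNorm_sum {A B : Type} [Fintype A] [Fintype B] (f : A ⊕ B → ZMod 2) :
    hammingNorm f = (hammingNorm fun a => f (.inl a)) + hammingNorm fun b => f (.inr b) := by
  simp only [hammingNorm, Finset.card_filter, Fintype.sum_sum_type]

open Classical in
theorem hammingNorm_adjacency_row {A B : Type} [Fintype A] (E : A → B → Prop) (b : B) :
    (hammingNorm fun a => adjacency E b a) = #{a | E a b} := by
  simp [hammingNorm, adjacency]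

open Classical in
theorem hammingNorm_adjacency_col {A B : Type} [Fintype B] (E : A → B → Prop) (a : A) :
    (hammingNorm fun b => adjacency E b a) = #{b | E a b} := by
  simp [hammingNorm, adjacency]

theorem CSSCode.maxWeight_eq {m n : Type} [Fintype m] [Fintype n] [Nonempty m]
    (H : Matrix m n (ZMod 2)) {w : ℕ} (hw : ∀ i, (hammingNorm fun j => H i j) = w) :
    CSSCode.maxWeight H = max w (univ.sup fun j => hammingNorm fun i => H i j) := by
  simp only [CSSCode.maxWeight, hw]
  rw [Finset.sup_const univ_nonempty]

variable {G : Type} [Group G] (X Y : FreeBipartiteGraph G)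

/-- The rows of `Hz` have weight `wD + wR` and those of `Hx` have weight `wU + wL`. A column has
only one of the four degrees as its weight, so the rows decide. Nonemptiness ensures that there are
rows. -/
theorem balancedProductCode_weight [Nonempty X.V₀] [Nonempty X.V₁] [Nonempty Y.V₀]
    [Nonempty Y.V₁] {wD wU wR wL : ℕ} (hX : IsBiregular X.E wD wU) (hY : IsBiregular Y.E wR wL) :
    (balancedProductCode X Y).weight = max (wD + wR) (wU + wL) := by
  classical
  have hv₀ := isBiregular_verticalEdge (B := Y.V₀) X Y.free₀ hX
  have hh₀ := isBiregular_horizontalEdge (A := X.V₀) Y X.free₀ hY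
  have hh₁ := isBiregular_horizontalEdge (A := X.V₁) Y X.free₁ hY
  have hv₁ := isBiregular_verticalEdge (B := Y.V₁) X Y.free₁ hX
  have : Nonempty (BalancedVertex G X.V₀ Y.V₀) :=
    ⟨.mk G (Classical.arbitrary _) (Classical.arbitrary _)⟩
  have : Nonempty (BalancedVertex G X.V₁ Y.V₁) :=
    ⟨.mk G (Classical.arbitrary _) (Classical.arbitrary _)⟩
  have hx : CSSCode.maxWeight (boundary₁ X Y) = max (wL + wU) _ :=
    CSSCode.maxWeight_eq _ fun v => by
      rw [hammingNorm_sum]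
      exact congrArg₂ (· + ·) ((hammingNorm_adjacency_row _ v).trans (hh₁.2 v))
        ((hammingNorm_adjacency_row _ v).trans (hv₁.2 v))
  have hz : CSSCode.maxWeight (boundary₂ X Y)ᵀ = max (wD + wR) _ :=
    CSSCode.maxWeight_eq _ fun z => by
      rw [hammingNorm_sum]
      exact congrArg₂ (· + ·) ((hammingNorm_adjacency_col _ z).trans (hv₀.1 z))
        ((hammingNorm_adjacency_col _ z).trans (hh₀.1 z))
  have hx' : (univ.sup fun i => hammingNorm fun v => boundary₁ X Y v i) ≤ wD + wR := by
    refine Finset.sup_le fun i _ => ?_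
    rcases i with q | p
    · refine (((hammingNorm_adjacency_col _ q).trans (hh₁.1 q)).le).trans ?_
      omega
    · refine (((hammingNorm_adjacency_col _ p).trans (hv₁.1 p)).le).trans ?_
      omega
  have hz' : (univ.sup fun i => hammingNorm fun z => (boundary₂ X Y)ᵀ z i) ≤ wU + wL := by
    refine Finset.sup_le fun i _ => ?_
    rcases i with q | p
    · refine (((hammingNorm_adjacency_row _ q).trans (hv₀.2 q)).le).trans ?_
      omega
    · refine (((hammingNorm_adjacency_row _ p).trans (hh₀.2 p)).le).trans ?_
      omega
  change max (CSSCode.maxWeight (boundary₁ X Y)) (CSSCode.maxWeight (boundary₂ X Y)ᵀ) = _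
  rw [hx, hz]
  omega

end Weight

/-! ### Rate, distance and length -/

section Parameters

theorem IsBiregular.card_mul_eq {A B : Type} [Fintype A] [Fintype B] {E : A → B → Prop}
    {w₀ w₁ : ℕ} (h : IsBiregular E w₀ w₁) : Fintype.card A * w₀ = Fintype.card B * w₁ := by
  classical
  have := sum_card_filter_comm E univ univ
  rw [Finset.sum_congr rfl fun a _ => h.1 a, Finset.sum_congr rfl fun b _ => h.2 b] at this
  simpa using this

/-- Otherwise the kernel of `Hz` lies in the row space of `Hx`, and rank-nullity gives `n ≤ rank Hx
+ rank Hz`. -/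
theorem CSSCode.exists_nontrivial (C : CSSCode) (h : 0 < C.dimension) :
    ∃ a b, C.IsLogical a b ∧ ¬ C.IsTrivialLogical a b := by
  classical
  by_contra! hcon
  have hle : LinearMap.ker C.Hz.mulVecLin ≤ LinearMap.range C.Hx.vecMulLinear := by
    intro a ha
    have ha' : C.Hz *ᵥ a = 0 := ha
    obtain ⟨⟨u, hu⟩, -⟩ := hcon a 0 ⟨ha', Matrix.mulVec_zero _⟩
    exact ⟨u, hu⟩
  have h1 := Submodule.finrank_mono hle
  have h2 := LinearMap.finrank_range_add_finrank_ker C.Hz.mulVecLin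
  have h3 : Module.finrank (ZMod 2) (LinearMap.range C.Hx.vecMulLinear) = C.Hx.rank := by
    rw [← Matrix.mulVecLin_transpose, ← Matrix.rank, Matrix.rank_transpose]
  have h4 : Module.finrank (ZMod 2) (LinearMap.range C.Hz.mulVecLin) = C.Hz.rank := rfl
  rw [Module.finrank_fintype_fun_eq_card] at h2
  rw [CSSCode.dimension, CSSCode.length] at h
  omega

/-- Neither part of a Pauli string outweighs the string, so the two types can be treated separately.
Positive dimension excludes the default value `0` of the infimum of the empty set. -/
theorem CSSCode.le_distance (C : CSSCode) (h : 0 < C.dimension) {d : ℝ}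
    (hX : ∀ a, C.Hz *ᵥ a = 0 → (hammingNorm a : ℝ) < d → ∃ u, u ᵥ* C.Hx = a)
    (hZ : ∀ b, C.Hx *ᵥ b = 0 → (hammingNorm b : ℝ) < d → ∃ v, v ᵥ* C.Hz = b) :
    d ≤ C.distance := by
  obtain ⟨a₀, b₀, h₀, h₀'⟩ := C.exists_nontrivial h
  obtain ⟨a, b, hlog, hnontriv, hd⟩ :=
    Nat.sInf_mem (s := {d | ∃ a b, C.IsLogical a b ∧ ¬ C.IsTrivialLogical a b ∧
      C.pauliWeight a b = d}) ⟨_, a₀, b₀, h₀, h₀', rfl⟩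
  change C.pauliWeight a b = C.distance at hd
  by_contra! hlt
  rw [← hd] at hlt
  have ha : hammingNorm a ≤ C.pauliWeight a b :=
    Finset.card_le_card fun q hq => by
      simp only [Finset.mem_filter, Finset.mem_univ, true_and] at hq ⊢
      exact Or.inl hq
  have hb : hammingNorm b ≤ C.pauliWeight a b :=
    Finset.card_le_card fun q hq => by
      simp only [Finset.mem_filter, Finset.mem_univ, true_and] at hq ⊢
      exact Or.inr hq
  exact hnontriv ⟨hX a hlog.1 (lt_of_le_of_lt (by exact_mod_cast ha) hlt),
    hZ b hlog.2 (lt_of_le_of_lt (by exact_mod_cast hb) hlt)⟩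

theorem HasVertexExpansion.smallSetExpansion {A B : Type} [Fintype A] [Fintype B]
    {E : A → B → Prop} {c α m : ℝ} (h : HasVertexExpansion E c α) (hm : m ≤ c * Fintype.card A) :
    SmallSetExpansion E m α :=
  fun S hS => h S (hS.trans_le hm)

variable {G : Type} [Group G] (X Y : FreeBipartiteGraph G)

/-- Each rank is at most the number of checks of its type. -/
theorem card_sub_le_dimension : (Fintype.card (BalancedVertex G X.V₁ Y.V₀) : ℝ) +
    Fintype.card (BalancedVertex G X.V₀ Y.V₁) - Fintype.card (BalancedVertex G X.V₀ Y.V₀) -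
    Fintype.card (BalancedVertex G X.V₁ Y.V₁) ≤ (balancedProductCode X Y).dimension := by
  classical
  have h1 : (boundary₁ X Y).rank ≤ Fintype.card (BalancedVertex G X.V₁ Y.V₁) :=
    Matrix.rank_le_card_height _
  have h2 : (boundary₂ X Y)ᵀ.rank ≤ Fintype.card (BalancedVertex G X.V₀ Y.V₀) :=
    Matrix.rank_le_card_height _
  have h3 : (balancedProductCode X Y).dimension = Fintype.card (BalancedVertex G X.V₁ Y.V₀) +
      Fintype.card (BalancedVertex G X.V₀ Y.V₁) -
        ((boundary₁ X Y).rank + (boundary₂ X Y)ᵀ.rank) := by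
    rw [← Fintype.card_sum]; rfl
  have h4 : Fintype.card (BalancedVertex G X.V₁ Y.V₀) +
      Fintype.card (BalancedVertex G X.V₀ Y.V₁) ≤ (balancedProductCode X Y).dimension +
      Fintype.card (BalancedVertex G X.V₀ Y.V₀) + Fintype.card (BalancedVertex G X.V₁ Y.V₁) := by
    omega
  have h5 : (Fintype.card (BalancedVertex G X.V₁ Y.V₀) : ℝ) +
      Fintype.card (BalancedVertex G X.V₀ Y.V₁) ≤ (balancedProductCode X Y).dimension +
      Fintype.card (BalancedVertex G X.V₀ Y.V₀) + Fintype.card (BalancedVertex G X.V₁ Y.V₁) := by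
    exact_mod_cast h4
  linarith

theorem balancedProductCode_length : ((balancedProductCode X Y).length : ℝ) =
    Fintype.card (BalancedVertex G X.V₁ Y.V₀) + Fintype.card (BalancedVertex G X.V₀ Y.V₁) := by
  have : (balancedProductCode X Y).length = Fintype.card (BalancedVertex G X.V₁ Y.V₀) +
      Fintype.card (BalancedVertex G X.V₀ Y.V₁) := by
    rw [← Fintype.card_sum]; rfl
  exact_mod_cast this

theorem card_balancedVertex_eq {wD wU wR wL : ℕ} (hU : 0 < wU) (hL : 0 < wL)
    (hX : IsBiregular X.E wD wU) (hY : IsBiregular Y.E wR wL) :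
    (Fintype.card (BalancedVertex G X.V₁ Y.V₀) : ℝ) =
        Fintype.card (BalancedVertex G X.V₀ Y.V₀) * (wD / wU) ∧
      (Fintype.card (BalancedVertex G X.V₀ Y.V₁) : ℝ) =
        Fintype.card (BalancedVertex G X.V₀ Y.V₀) * (wR / wL) ∧
      (Fintype.card (BalancedVertex G X.V₁ Y.V₁) : ℝ) =
        Fintype.card (BalancedVertex G X.V₀ Y.V₀) * (wD / wU) * (wR / wL) := by
  have hU' : (0 : ℝ) < wU := by exact_mod_cast hU
  have hL' : (0 : ℝ) < wL := by exact_mod_cast hL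
  have h1 := (isBiregular_verticalEdge (B := Y.V₀) X Y.free₀ hX).card_mul_eq
  have h2 := (isBiregular_horizontalEdge (A := X.V₀) Y X.free₀ hY).card_mul_eq
  have h3 := (isBiregular_horizontalEdge (A := X.V₁) Y X.free₁ hY).card_mul_eq
  have e1 : (Fintype.card (BalancedVertex G X.V₁ Y.V₀) : ℝ) =
        Fintype.card (BalancedVertex G X.V₀ Y.V₀) * (wD / wU) := by
    rw [mul_div_assoc', eq_div_iff hU'.ne']
    exact_mod_cast h1.symm
  refine ⟨e1, ?_, ?_⟩
  · rw [mul_div_assoc', eq_div_iff hL'.ne']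
    exact_mod_cast h2.symm
  · rw [← e1, mul_div_assoc', eq_div_iff hL'.ne']
    exact_mod_cast h3.symm

/-- In units of `|V₀₀|`, qubits minus checks factor as `(wD / wU - 1) * (1 - wR / wL)`, and the
number of qubits is `wD / wU + wR / wL`. -/
theorem rate_le_dimension_div_length {wD wU wR wL : ℕ} (hU : 0 < wU) (hL : 0 < wL)
    (hD : 0 < wD) (hX : IsBiregular X.E wD wU) (hY : IsBiregular Y.E wR wL)
    (hcard : 0 < Fintype.card (BalancedVertex G X.V₀ Y.V₀)) :
    ((wD : ℝ) - wU) * ((wL : ℝ) - wR) / ((wD : ℝ) * wL + (wU : ℝ) * wR) ≤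
      ((balancedProductCode X Y).dimension : ℝ) / (balancedProductCode X Y).length := by
  have hdim := card_sub_le_dimension X Y
  rw [balancedProductCode_length]
  obtain ⟨h1, h2, h3⟩ := card_balancedVertex_eq X Y hU hL hX hY
  rw [h1, h2, h3] at hdim
  rw [h1, h2]
  have hU' : (0 : ℝ) < wU := by exact_mod_cast hU
  have hL' : (0 : ℝ) < wL := by exact_mod_cast hL
  have hD' : (0 : ℝ) < wD := by exact_mod_cast hD
  have hc : (0 : ℝ) < Fintype.card (BalancedVertex G X.V₀ Y.V₀) := by exact_mod_cast hcard
  have hn : (0 : ℝ) < Fintype.card (BalancedVertex G X.V₀ Y.V₀) * (wD / wU) +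
      Fintype.card (BalancedVertex G X.V₀ Y.V₀) * (wR / wL) := by positivity
  refine le_trans (le_of_eq ?_) (div_le_div_of_nonneg_right hdim hn.le)
  field_simp
  ring

/-- The denominator is a common upper bound for the constants of the homological and the
cohomological statement. -/
theorem le_balancedProductCode_distance {wD wU wR wL : ℕ} (hD : 0 < wD) (hU : 0 < wU)
    (hR : 0 < wR) (hL : 0 < wL) {cV cH εV εH m : ℝ} (hX : IsLosslessExpander X.E wD wU cV εV)
    (hY : IsLosslessExpander Y.E wR wL cH εH) (hεV : 0 ≤ εV) (hεV' : εV ≤ 1 / 400) (hεH : 0 ≤ εH)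
    (hεHU : εH * wU ≤ 1 / 400) (hεHD : εH * wD ≤ 1 / 400) (hX₀ : m ≤ cV * Fintype.card X.V₀)
    (hX₁ : m ≤ cV * Fintype.card X.V₁) (hY₀ : m ≤ cH * Fintype.card Y.V₀)
    (hY₁ : m ≤ cH * Fintype.card Y.V₁) (hdim : 0 < (balancedProductCode X Y).dimension) :
    m / (20 * (wD + wU) * (wR + wL + 1) * (wD + wU + wR + wL)) ≤
      ((balancedProductCode X Y).distance : ℝ) := by
  have hD' : (0 : ℝ) < wD := by exact_mod_cast hD
  refine CSSCode.le_distance _ hdim (fun c hc hsmall => ?_) (fun c hc hsmall => ?_)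
  all_goals rw [lt_div_iff₀ (by positivity)] at hsmall
  · refine exists_vecMul_boundary₁_eq X Y hD hU hL hX.1 hY.1 hεV hεV' hεH hεHD
      (hX.2.2.smallSetExpansion hX₁) (hY.2.2.smallSetExpansion hY₁) c hc (lt_of_le_of_lt ?_ hsmall)
    rw [mul_comm (hammingNorm c : ℝ)]
    gcongr ?_ * _
    gcongr ?_ * ?_ * ?_
    all_goals linarith [(Nat.cast_nonneg wU : (0 : ℝ) ≤ wU), (Nat.cast_nonneg wR : (0 : ℝ) ≤ wR),
      (Nat.cast_nonneg wL : (0 : ℝ) ≤ wL)]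
  · obtain ⟨v, hv⟩ := exists_boundary₂_mulVec_eq X Y hD hU hR hX.1 hY.1 hεV hεV' hεH hεHU
      (hX.2.1.smallSetExpansion hX₀) (hY.2.1.smallSetExpansion hY₀) c hc (lt_of_le_of_lt (by
        rw [mul_comm (hammingNorm c : ℝ)]
        gcongr ?_ * _
        gcongr ?_ * ?_ * ?_
        all_goals linarith [(Nat.cast_nonneg wU : (0 : ℝ) ≤ wU),
          (Nat.cast_nonneg wR : (0 : ℝ) ≤ wR), (Nat.cast_nonneg wL : (0 : ℝ) ≤ wL)]) hsmall)
    exact ⟨v, (Matrix.vecMul_transpose _ _).trans hv⟩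

/-- The length and the expansion threshold are both linear in `|G|`. The lower bounds are assumed
for the smaller sides `X.V₀` and `Y.V₁`, so they hold on all four sides. -/
theorem balancedProductCode_parameters [Fintype G] {wD wU wR wL : ℕ} (hU : 0 < wU)
    (hUD : wU < wD) (hR : 0 < wR) (hRL : wR < wL) {cV cH εV εH κ₁ κ₂ : ℝ} (hcV : 0 < cV)
    (hcH : 0 < cH) (hκ₁ : 0 < κ₁) (hX : IsLosslessExpander X.E wD wU cV εV)
    (hY : IsLosslessExpander Y.E wR wL cH εH) (hεV : 0 ≤ εV) (hεV' : εV ≤ 1 / 400) (hεH : 0 ≤ εH)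
    (hεH' : εH * wD ≤ 1 / 400) (hX₁ : κ₁ * Fintype.card G ≤ Fintype.card X.V₀)
    (hX₂ : Fintype.card X.V₀ ≤ κ₂ * Fintype.card G)
    (hY₁ : κ₁ * Fintype.card G ≤ Fintype.card Y.V₁)
    (hY₂ : Fintype.card Y.V₀ ≤ κ₂ * Fintype.card G) :
    κ₁ ^ 2 * Fintype.card G ≤ (balancedProductCode X Y).length ∧
      ((wD : ℝ) - wU) * ((wL : ℝ) - wR) / ((wD : ℝ) * wL + (wU : ℝ) * wR) ≤
        ((balancedProductCode X Y).dimension : ℝ) / (balancedProductCode X Y).length ∧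
      min cV cH * κ₁ / (20 * (wD + wU) * (wR + wL + 1) * (wD + wU + wR + wL)) /
          ((wD + wR) * κ₂ ^ 2) ≤
        ((balancedProductCode X Y).distance : ℝ) / (balancedProductCode X Y).length ∧
      (balancedProductCode X Y).weight = max (wD + wR) (wU + wL) := by
  have hU' : (1 : ℝ) ≤ wU := by exact_mod_cast hU
  have hR' : (1 : ℝ) ≤ wR := by exact_mod_cast hR
  have hUD' : (wU : ℝ) < wD := by exact_mod_cast hUD
  have hRL' : (wR : ℝ) < wL := by exact_mod_cast hRL
  have hD : 0 < wD := hU.trans hUD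
  have hL : 0 < wL := hR.trans hRL
  have hD' : (1 : ℝ) ≤ wD := by exact_mod_cast hD
  have hL' : (1 : ℝ) ≤ wL := by exact_mod_cast hL
  have hG : (0 : ℝ) < Fintype.card G := by exact_mod_cast Fintype.card_pos
  have hX₀₁ : (Fintype.card X.V₀ : ℝ) ≤ Fintype.card X.V₁ := by
    have h := hX.1.card_mul_eq
    exact_mod_cast Nat.le_of_mul_le_mul_right (h.le.trans (Nat.mul_le_mul_left _ hUD.le)) hD
  have hY₀₁ : (Fintype.card Y.V₁ : ℝ) ≤ Fintype.card Y.V₀ := by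
    have h := hY.1.card_mul_eq
    exact_mod_cast Nat.le_of_mul_le_mul_right (h.ge.trans (Nat.mul_le_mul_left _ hRL.le)) hL
  have hκG : 0 < κ₁ * Fintype.card G := by positivity
  have hκ₂ : 0 < κ₂ := pos_of_mul_pos_left (hκG.trans_le (hX₁.trans hX₂)) hG.le
  have : Nonempty X.V₀ := Fintype.card_pos_iff.1 (by exact_mod_cast hκG.trans_le hX₁)
  have : Nonempty X.V₁ := Fintype.card_pos_iff.1
    (by exact_mod_cast hκG.trans_le (hX₁.trans hX₀₁))
  have : Nonempty Y.V₁ := Fintype.card_pos_iff.1 (by exact_mod_cast hκG.trans_le hY₁)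
  have : Nonempty Y.V₀ := Fintype.card_pos_iff.1
    (by exact_mod_cast hκG.trans_le (hY₁.trans hY₀₁))
  have hcard : (Fintype.card (BalancedVertex G X.V₀ Y.V₀) : ℝ) * Fintype.card G =
      Fintype.card X.V₀ * Fintype.card Y.V₀ := by
    exact_mod_cast card_balancedVertex_mul_card (B := Y.V₀) X.free₀
  have hcard₁ : κ₁ ^ 2 * Fintype.card G ≤ Fintype.card (BalancedVertex G X.V₀ Y.V₀) := by
    refine le_of_mul_le_mul_right ?_ hG
    rw [hcard]
    calc κ₁ ^ 2 * Fintype.card G * Fintype.card G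
        = (κ₁ * Fintype.card G) * (κ₁ * Fintype.card G) := by ring
      _ ≤ _ := mul_le_mul hX₁ (hY₁.trans hY₀₁) hκG.le (by positivity)
  have hcard₂ : Fintype.card (BalancedVertex G X.V₀ Y.V₀) ≤ κ₂ ^ 2 * Fintype.card G := by
    refine le_of_mul_le_mul_right ?_ hG
    rw [hcard]
    calc _ ≤ (κ₂ * Fintype.card G) * (κ₂ * Fintype.card G) :=
          mul_le_mul hX₂ hY₂ (by positivity) (by positivity)
      _ = κ₂ ^ 2 * Fintype.card G * Fintype.card G := by ring
  have hcard₀ : (0 : ℝ) < Fintype.card (BalancedVertex G X.V₀ Y.V₀) :=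
    lt_of_lt_of_le (by positivity) hcard₁
  have hlen := balancedProductCode_length X Y
  obtain ⟨h1, h2, -⟩ := card_balancedVertex_eq X Y hU hL hX.1 hY.1
  rw [h1, h2, ← mul_add] at hlen
  have hdeg₁ : (1 : ℝ) ≤ wD / wU + wR / wL := by
    have : (1 : ℝ) ≤ wD / wU := (one_le_div (by positivity)).2 hUD'.le
    have : (0 : ℝ) ≤ wR / wL := by positivity
    linarith
  have hdeg₂ : (wD / wU + wR / wL : ℝ) ≤ wD + wR :=
    add_le_add (div_le_self (by positivity) hU') (div_le_self (by positivity) hL')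
  have hlen₁ : κ₁ ^ 2 * Fintype.card G ≤ (balancedProductCode X Y).length := by
    rw [hlen]
    exact hcard₁.trans (le_mul_of_one_le_right hcard₀.le hdeg₁)
  have hlen₂ : (balancedProductCode X Y).length ≤ κ₂ ^ 2 * Fintype.card G * (wD + wR) := by
    rw [hlen]
    exact mul_le_mul hcard₂ hdeg₂ (by positivity) (by positivity)
  have hlen₀ : (0 : ℝ) < (balancedProductCode X Y).length := lt_of_lt_of_le (by positivity) hlen₁
  have hrate := rate_le_dimension_div_length X Y hU hL hD hX.1 hY.1 (by exact_mod_cast hcard₀)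
  have hdim : 0 < (balancedProductCode X Y).dimension := by
    have h : (0 : ℝ) < ((wD : ℝ) - wU) * ((wL : ℝ) - wR) / ((wD : ℝ) * wL + (wU : ℝ) * wR) :=
      div_pos (mul_pos (sub_pos.2 hUD') (sub_pos.2 hRL')) (by positivity)
    have h' := h.trans_le hrate
    rw [div_pos_iff_of_pos_right hlen₀] at h'
    exact_mod_cast h'
  refine ⟨hlen₁, hrate, ?_, balancedProductCode_weight X Y hX.1 hY.1⟩
  have hmin : 0 < min cV cH := lt_min hcV hcH
  -- The common threshold is `m = min cV cH * κ₁ * |G|`.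
  have hm : ∀ {c N : ℝ}, min cV cH ≤ c → κ₁ * Fintype.card G ≤ N →
      min cV cH * (κ₁ * Fintype.card G) ≤ c * N := fun hc hN =>
    mul_le_mul hc hN hκG.le (hmin.le.trans hc)
  have hdist := le_balancedProductCode_distance X Y hD hU hR hL hX hY hεV hεV' hεH
    ((mul_le_mul_of_nonneg_left hUD'.le hεH).trans hεH') hεH'
    (hm (min_le_left _ _) hX₁) (hm (min_le_left _ _) (hX₁.trans hX₀₁))
    (hm (min_le_right _ _) (hY₁.trans hY₀₁)) (hm (min_le_right _ _) hY₁) hdim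
  rw [le_div_iff₀ hlen₀]
  refine le_trans ?_ hdist
  refine (mul_le_mul_of_nonneg_left hlen₂ (by positivity)).trans (le_of_eq ?_)
  field_simp

end Parameters

/-! ### Choice of the parameters -/

theorem IsLosslessExpander.swap {A B : Type} [Fintype A] [Fintype B] {E : A → B → Prop}
    {w₀ w₁ : ℕ} {c ε : ℝ} (h : IsLosslessExpander E w₀ w₁ c ε) :
    IsLosslessExpander (fun b a => E a b) w₁ w₀ c ε :=
  ⟨⟨h.1.2, h.1.1⟩, h.2.2, h.2.1⟩

/-- If `a ≤ w₀ / w₁ ≤ 1`, then the sizes of the two sides of a `(w₀, w₁)`-regular graph differ at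
most by the factor `a`. -/
theorem IsBiregular.card_right_bounds {A B : Type} [Fintype A] [Fintype B] {E : A → B → Prop}
    {w₀ w₁ : ℕ} (h : IsBiregular E w₀ w₁) (h₁ : 0 < w₁) {a : ℝ} (ha : a ≤ (w₀ : ℝ) / w₁)
    (h₀₁ : w₀ ≤ w₁) : a * Fintype.card A ≤ Fintype.card B ∧
      (Fintype.card B : ℝ) ≤ Fintype.card A := by
  have h₁' : (0 : ℝ) < w₁ := by exact_mod_cast h₁
  have hB : (Fintype.card B : ℝ) = w₀ / w₁ * Fintype.card A := by
    rw [div_mul_eq_mul_div, eq_div_iff h₁'.ne', mul_comm (w₀ : ℝ)]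
    exact_mod_cast h.card_mul_eq.symm
  rw [hB]
  exact ⟨by gcongr, mul_le_of_le_one_left (by positivity)
    ((div_le_one h₁').2 (by exact_mod_cast h₀₁))⟩

/-- The expression is smallest when both degree ratios equal `b`, where it is `(1 - b)² / (1 + b²)`.
With `r = 1 - 4 * b` this is at least `r`. -/
theorem rate_bound {r b wD wU wR wL : ℝ} (hr₀ : 0 < r) (hr₁ : r < 1) (hb : b = (1 - r) / 4)
    (hD : 0 < wD) (hL : 0 < wL) (hU : 0 ≤ wU) (hR : 0 ≤ wR) (hUD : wU ≤ b * wD)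
    (hRL : wR ≤ b * wL) : r ≤ (wD - wU) * (wL - wR) / (wD * wL + wU * wR) := by
  have hb0 : 0 < b := by rw [hb]; linarith
  have hb1 : b < 1 := by rw [hb]; linarith
  have hDL : 0 < wD * wL := by positivity
  rw [le_div_iff₀ (by positivity)]
  have h1 : (1 - b) * wD * ((1 - b) * wL) ≤ (wD - wU) * (wL - wR) :=
    mul_le_mul (by linarith) (by linarith) (by nlinarith) (by nlinarith)
  have h2 : wU * wR ≤ b * wD * (b * wL) := mul_le_mul hUD hRL hR (by positivity)
  have h3 : r * (1 + b * b) ≤ (1 - b) * (1 - b) := by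
    have : r * (b * b) ≤ b * b := mul_le_of_le_one_left (by positivity) hr₁.le
    have : r = 1 - 4 * b := by linarith
    nlinarith
  calc r * (wD * wL + wU * wR) ≤ r * (wD * wL + b * wD * (b * wL)) := by gcongr
    _ = r * (1 + b * b) * (wD * wL) := by ring
    _ ≤ (1 - b) * (1 - b) * (wD * wL) := by gcongr
    _ = (1 - b) * wD * ((1 - b) * wL) := by ring
    _ ≤ _ := h1

theorem theorem1 (hconj : LosslessExpanderConjecture) (r : ℝ) (hr₀ : 0 < r) (hr₁ : r < 1) :
    ∃ (δ : ℝ) (w : ℕ), 0 < δ ∧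
      -- the degrees, the expansion parameters and the constants of the linear size
      ∃ (wDown wUp wRight wLeft : ℕ) (cV cH εV εH κ₁ κ₂ : ℝ),
        0 < cV ∧ 0 < cH ∧ 0 < εV ∧ 0 < εH ∧ 0 < κ₁ ∧
        r ≤ ((wDown : ℝ) - wUp) * ((wLeft : ℝ) - wRight) /
          ((wDown : ℝ) * wLeft + (wUp : ℝ) * wRight) ∧
        εV * wDown ≤ wUp ∧ εV * wUp ≤ wDown ∧
        wUp * εH < 1 / 12 ∧ wDown * εH < 1 / 12 ∧ εV < 1 / 12 ∧ εH < 1 / 12 ∧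
        -- the groups and the graphs whose balanced products give the codes
        ∃ (G : ℕ → Type) (_ : ∀ i, Group (G i)) (_ : ∀ i, Fintype (G i))
          (X Y : ∀ i, FreeBipartiteGraph (G i)),
          (∀ i, IsLosslessExpander (X i).E wDown wUp cV εV ∧
            IsLosslessExpander (Y i).E wRight wLeft cH εH ∧
            κ₁ * Fintype.card (G i) ≤ Fintype.card (X i).V₀ ∧
            Fintype.card (X i).V₀ ≤ κ₂ * Fintype.card (G i) ∧
            κ₁ * Fintype.card (G i) ≤ Fintype.card (Y i).V₀ ∧
            Fintype.card (Y i).V₀ ≤ κ₂ * Fintype.card (G i)) ∧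
          Tendsto (fun i => Fintype.card (G i)) atTop atTop ∧
          -- the parameters of the codes
          Tendsto (fun i => (balancedProductCode (X i) (Y i)).length) atTop atTop ∧
          ∀ i, r ≤ ((balancedProductCode (X i) (Y i)).dimension : ℝ) /
              (balancedProductCode (X i) (Y i)).length ∧
            δ ≤ ((balancedProductCode (X i) (Y i)).distance : ℝ) /
              (balancedProductCode (X i) (Y i)).length ∧
            (balancedProductCode (X i) (Y i)).weight = w := by
 
  obtain ⟨G, hGrp, hFin, hG, hexp⟩ := hconj
  obtain ⟨b, hb⟩ : ∃ b : ℝ, b = (1 - r) / 4 := ⟨_, rfl⟩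
  -- Any `a` strictly between `0` and `b` would do. Positivity excludes vanishing degrees, including
  -- `w₁ = 0`, where the quotient is `0` by convention.
  obtain ⟨a, ha⟩ : ∃ a : ℝ, a = b / 2 := ⟨_, rfl⟩
  have hb0 : 0 < b := by rw [hb]; linarith
  have hb1 : b < 1 := by rw [hb]; linarith
  have ha0 : 0 < a := by rw [ha]; linarith
  have hab : a < b := by rw [ha]; linarith
  have hratio : ∀ {w₀ w₁ : ℕ}, a < (w₀ : ℝ) / w₁ → (w₀ : ℝ) / w₁ < b →
      0 < w₀ ∧ 0 < w₁ ∧ a * w₁ ≤ w₀ ∧ (w₀ : ℝ) ≤ b * w₁ ∧ w₀ < w₁ := by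
    intro w₀ w₁ h1 h2
    have h0 : 0 < w₀ := Nat.pos_of_ne_zero fun h => by simp [h] at h1; linarith
    have h0' : 0 < w₁ := Nat.pos_of_ne_zero fun h => by simp [h] at h1; linarith
    have h3 : (0 : ℝ) < w₁ := by exact_mod_cast h0'
    rw [lt_div_iff₀ h3] at h1
    rw [div_lt_iff₀ h3] at h2
    refine ⟨h0, h0', h1.le, h2.le, ?_⟩
    have : (w₀ : ℝ) < w₁ := h2.trans_le (mul_le_of_le_one_left h3.le hb1.le)
    exact_mod_cast this
  -- The bound by `a` yields `εV * wD ≤ wU`, as `a ≤ wU / wD`.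
  obtain ⟨εV, hεV⟩ : ∃ εV : ℝ, εV = min (1 / 400) a := ⟨_, rfl⟩
  have hεV0 : 0 < εV := by rw [hεV]; exact lt_min (by norm_num) ha0
  have hεV1 : εV ≤ 1 / 400 := hεV ▸ min_le_left _ _
  have hεVa : εV ≤ a := hεV ▸ min_le_right _ _
  obtain ⟨wU, wD, cV, μ₁, μ₂, i₀, hcV, hμ₁, hUD₁, hUD₂, hXs⟩ :=
    hexp εV hεV0 a b ha0.le hab hb1.le
  obtain ⟨hU, hD, hUDa, hUDb, hUD⟩ := hratio hUD₁ hUD₂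
  have hD' : (1 : ℝ) ≤ wD := by exact_mod_cast hD
  have hUD' : (wU : ℝ) ≤ wD := by exact_mod_cast hUD.le
  -- This depends on the degree `wD` of the graphs `X`, so the conjecture is applied for `Y` only
  -- now.
  obtain ⟨εH, hεH⟩ : ∃ εH : ℝ, εH = 1 / (400 * wD) := ⟨_, rfl⟩
  have hεH0 : 0 < εH := by rw [hεH]; positivity
  have hεHD : εH * wD = 1 / 400 := by rw [hεH]; field_simp
  have hεHU : εH * wU ≤ 1 / 400 := by rw [← hεHD]; gcongr
  have hεH1 : εH ≤ 1 / 400 := by rw [← hεHD]; exact le_mul_of_one_le_right hεH0.le hD'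
  obtain ⟨wR, wL, cH, ν₁, ν₂, j₀, hcH, hν₁, hRL₁, hRL₂, hYs⟩ :=
    hexp εH hεH0 a b ha0.le hab hb1.le
  obtain ⟨hR, hL, hRLa, hRLb, hRL⟩ := hratio hRL₁ hRL₂
  -- The common shift places both graphs over the same group, beyond both starting indices.
  choose X hX hXμ₁ hXμ₂ using fun i => hXs (i + (i₀ + j₀)) (by omega)
  choose Y hY hYν₁ hYν₂ using fun i => hYs (i + (i₀ + j₀)) (by omega)
  have hmin : 0 < min μ₁ ν₁ := lt_min hμ₁ hν₁
  have hGpos : ∀ i, (0 : ℝ) < Fintype.card (G i) := fun i => by exact_mod_cast Fintype.card_pos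
  have hX₁ : ∀ i, a * min μ₁ ν₁ * Fintype.card (G (i + (i₀ + j₀))) ≤ Fintype.card (X i).V₁ := by
    intro i
    refine le_trans ?_ ((hX i).1.card_right_bounds hD hUD₁.le hUD.le).1
    rw [mul_assoc]
    gcongr
    exact le_trans (by gcongr; exact min_le_left _ _) (hXμ₁ i)
  have hX₂ : ∀ i, Fintype.card (X i).V₁ ≤ max μ₂ ν₂ * Fintype.card (G (i + (i₀ + j₀))) := by
    intro i
    refine (((hX i).1.card_right_bounds hD hUD₁.le hUD.le).2.trans (hXμ₂ i)).trans ?_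
    gcongr
    exact le_max_left _ _
  have hY₁ : ∀ i, a * min μ₁ ν₁ * Fintype.card (G (i + (i₀ + j₀))) ≤ Fintype.card (Y i).V₁ := by
    intro i
    refine le_trans ?_ ((hY i).1.card_right_bounds hL hRL₁.le hRL.le).1
    rw [mul_assoc]
    gcongr
    exact le_trans (by gcongr; exact min_le_right _ _) (hYν₁ i)
  have hY₂ : ∀ i, Fintype.card (Y i).V₀ ≤ max μ₂ ν₂ * Fintype.card (G (i + (i₀ + j₀))) := by
    intro i
    refine (hYν₂ i).trans ?_
    gcongr
    exact le_max_right _ _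
  have hκ₂ : 0 < max μ₂ ν₂ := by
    have h := (hX₁ 0).trans (hX₂ 0)
    exact pos_of_mul_pos_left (lt_of_lt_of_le (mul_pos (mul_pos ha0 hmin) (hGpos _)) h)
      (hGpos _).le
  -- The conjecture supplies graphs with `w₀ < w₁`, whose larger side is `V₀`. The first factor
  -- needs the opposite, so it is swapped; bounding its new `V₀` from below costs the factor `a` in
  -- `κ₁`.
  have hpar := fun i => balancedProductCode_parameters (X i).swap (Y i) hU hUD hR hRL hcV hcH
    (mul_pos ha0 hmin) (hX i).swap (hY i) hεV0.le hεV1 hεH0.le hεHD.le (hX₁ i) (hX₂ i) (hY₁ i)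
    (hY₂ i)
  have hrate : r ≤ ((wD : ℝ) - wU) * ((wL : ℝ) - wR) / ((wD : ℝ) * wL + (wU : ℝ) * wR) :=
    rate_bound hr₀ hr₁ hb (by exact_mod_cast hD) (by exact_mod_cast hL) (by positivity)
      (by positivity) hUDb hRLb
  have hGshift : Tendsto (fun i => Fintype.card (G (i + (i₀ + j₀)))) atTop atTop :=
    hG.comp (tendsto_add_atTop_nat _)
  refine ⟨_, max (wD + wR) (wU + wL), ?_, wD, wU, wR, wL, cV, cH, εV, εH, a * min μ₁ ν₁,
    max μ₂ ν₂, hcV, hcH, hεV0, hεH0, mul_pos ha0 hmin, hrate, ?_, ?_, ?_, ?_, ?_, ?_,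
    fun i => G (i + (i₀ + j₀)), fun i => hGrp _, fun i => hFin _, fun i => (X i).swap, Y,
    fun i => ⟨(hX i).swap, hY i, hX₁ i, hX₂ i, ?_, hY₂ i⟩, hGshift, ?_,
    fun i => ⟨hrate.trans (hpar i).2.1, (hpar i).2.2.1, (hpar i).2.2.2⟩⟩
  · have : 0 < min cV cH := lt_min hcV hcH
    positivity
  · exact le_trans (by gcongr) hUDa
  · exact (mul_le_of_le_one_left (by positivity) (by linarith)).trans hUD'
  · rw [mul_comm]; linarith
  · rw [mul_comm]; linarith
  · linarith
  · linarith
  · refine (hY₁ i).trans ?_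
    have h := (hY i).1.card_right_bounds hL hRL₁.le hRL.le
    exact h.2
  · have h : Tendsto (fun i => (a * min μ₁ ν₁) ^ 2 * (Fintype.card (G (i + (i₀ + j₀))) : ℝ))
        atTop atTop :=
      (tendsto_natCast_atTop_atTop.comp hGshift).const_mul_atTop (pow_pos (mul_pos ha0 hmin) 2)
    exact tendsto_natCast_atTop_iff.1 (tendsto_atTop_mono (fun i => (hpar i).1) h)
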